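/- **Laplace approximation on constrained submanifolds.** Let $mn\le d$, let $F:\mathbb{R}^d\to\mathbb{R}^{mn}$ be $C^\infty$, let $y\in\mathbb{R}^{mn}$ and $\mathcal{M}=F^{-1}(y)$, and assume that the Jacobian $DF(\theta)$ has full rank $mn$ at every $\theta\in\mathcal{M}$. Let $\eta,Q:\mathbb{R}^d\to[0,\infty)$ be $C^\infty$. Assume that $\eta$ attains a unique global minimum on $\mathcal{M}$ at $\theta^\star\in\mathcal{M}$, and that this minimum is well separated: for every neighbourhood $N$ of $\theta^\star$ there is $\delta>0$ with $\eta\ge\eta(\theta^\star)+\delta$ on $\mathcal{M}\setminus N$. Assume also that $Q(\theta^\star)\neq 0$ and that $e^{-\eta/\tau_0}Q$ is integrable over $\mathcal{M}$ with respect to $\mathcal{H}^{d-mn}$ for some $\tau_0>0$, where $\mathcal{H}^{k}$ is $k$-dimensional Hausdorff measure on $\mathbb{R}^d$, normalized to agree with Lebesgue measure on $\mathbb{R}^k$. Write $J=DF\,DF^\top$ and $\Pi=I-DF^\top J^{-1}DF$. At points of $\mathcal{M}$, $\Pi(\theta)$ is the orthogonal projection onto the tangent space of $\mathcal{M}$.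 Let $U\in\mathbb{R}^{d\times(d-mn)}$ be any matrix with $U^\top U=I$ and $UU^\top=\Pi(\theta^\star)$. Define the manifold Hessian $\nabla^2_{\mathcal{M}}\eta(\theta^\star)\in\mathbb{R}^{(d-mn)\times(d-mn)}$ by $$\nabla^2_{\mathcal{M}}\eta(\theta^\star)\,u=U^\top\bigl(\nabla^2\eta(\theta^\star)\,Uu+[\nabla_{Uu}\Pi(\theta^\star)]\,\nabla\eta(\theta^\star)\bigr),\qquad u\in\mathbb{R}^{d-mn},$$ where $\nabla_v\Pi$ is the entrywise directional derivative of $\Pi$ in the direction $v$. Assume that $\nabla^2_{\mathcal{M}}\eta(\theta^\star)$ is non-singular. Then $\det\nabla^2_{\mathcal{M}}\eta(\theta^\star)>0$, the function $e^{-\eta/\tau}Q$ is integrable over $\mathcal{M}$ for all sufficiently small $\tau>0$, and as $\tau\to0^+$ $$\int_{\mathcal{M}}e^{-\frac1\tau\eta(\theta)}Q(\theta)\,\mathrm{d}\mathcal{H}^{d-mn}(\theta)=(2\pi\tau)^{\frac{d-mn}{2}}e^{-\frac1\tau\eta(\theta^\star)}Q(\theta^\star)\det\bigl(\nabla^2_{\mathcal{M}}\eta(\theta^\star)\bigr)^{-1/2}\,[1+\mathcal{O}(\tau)].$$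 -/

import Mathlib

open MeasureTheory Filter Topology
open scoped ContDiff Matrix

noncomputable section

namespace ConstrainedLaplace

variable {d k p : ℕ}

/-- Gradient `∇R(θ)` as a coordinate vector. -/
def grad (R : EuclideanSpace ℝ (Fin d) → ℝ) (θ : EuclideanSpace ℝ (Fin d)) : Fin d → ℝ :=
  fun i => fderiv ℝ R θ (EuclideanSpace.single i 1)

/-- Euclidean Hessian matrix `∇²R(θ)`, with entries `∂ᵢ∂ⱼR(θ)`. -/
def hessian (R : EuclideanSpace ℝ (Fin d) → ℝ) (θ : EuclideanSpace ℝ (Fin d)) :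
    Matrix (Fin d) (Fin d) ℝ :=
  Matrix.of fun i j => fderiv ℝ (fun x => grad R x j) θ (EuclideanSpace.single i 1)

/-- Jacobian matrix `DF(θ)`, with entries `∂ⱼFᵢ(θ)`. -/
def jacobian (F : EuclideanSpace ℝ (Fin d) → EuclideanSpace ℝ (Fin k))
    (θ : EuclideanSpace ℝ (Fin d)) : Matrix (Fin k) (Fin d) ℝ :=
  Matrix.of fun i j => (fderiv ℝ F θ (EuclideanSpace.single j 1)) i

/-- `J(θ) = DF(θ) DF(θ)ᵀ`. -/
def gram (F : EuclideanSpace ℝ (Fin d) → EuclideanSpace ℝ (Fin k))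
    (θ : EuclideanSpace ℝ (Fin d)) : Matrix (Fin k) (Fin k) ℝ :=
  jacobian F θ * (jacobian F θ)ᵀ

/-- `Π(θ) = I - DF(θ)ᵀ J(θ)⁻¹ DF(θ)`: where `DF(θ)` has full rank `k`, the orthogonal projection
onto `ker DF(θ)`, the tangent space at `θ` of the fibre of `F` through `θ`. -/
def tangentProj (F : EuclideanSpace ℝ (Fin d) → EuclideanSpace ℝ (Fin k))
    (θ : EuclideanSpace ℝ (Fin d)) : Matrix (Fin d) (Fin d) ℝ :=
  1 - (jacobian F θ)ᵀ * (gram F θ)⁻¹ * jacobian F θ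

/-- The entrywise directional derivative `∇_v Π(θ)` of the tangent projection. -/
def dirDerivProj (F : EuclideanSpace ℝ (Fin d) → EuclideanSpace ℝ (Fin k))
    (θ : EuclideanSpace ℝ (Fin d)) (v : Fin d → ℝ) : Matrix (Fin d) (Fin d) ℝ :=
  Matrix.of fun i j => fderiv ℝ (fun x => tangentProj F x i j) θ (WithLp.toLp 2 v)

/-- `U` is the factor of a compact singular value decomposition `Π(θ) = U Uᵀ`: its columns form an
orthonormal basis of the tangent space. -/
def IsTangentFrame (F : EuclideanSpace ℝ (Fin d) → EuclideanSpace ℝ (Fin k))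
    (θ : EuclideanSpace ℝ (Fin d)) (U : Matrix (Fin d) (Fin p) ℝ) : Prop :=
  Uᵀ * U = 1 ∧ U * Uᵀ = tangentProj F θ

/-- The manifold Hessian `∇²_𝓜 R(θ)` of `R` on the fibre of `F` through `θ`, in the tangent frame
`U`: the matrix whose `b`-th column is its action
`u ↦ Uᵀ (∇²R(θ) U u + ∇_{U u} Π(θ) ∇R(θ))` on the `b`-th standard basis vector. -/
def manifoldHessian (F : EuclideanSpace ℝ (Fin d) → EuclideanSpace ℝ (Fin k))
    (R : EuclideanSpace ℝ (Fin d) → ℝ) (θ : EuclideanSpace ℝ (Fin d))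
    (U : Matrix (Fin d) (Fin p) ℝ) : Matrix (Fin p) (Fin p) ℝ :=
  Matrix.of fun a b =>
    (Uᵀ *ᵥ (hessian R θ *ᵥ (U *ᵥ Pi.single b 1) +
      dirDerivProj F θ (U *ᵥ Pi.single b 1) *ᵥ grad R θ)) a

end ConstrainedLaplace

end

/-! Near the minimum `θ⋆` the fibre is parametrized by a smooth chart `ψ` that is linear in
tangential coordinates; it comes from the inverse function theorem (`exists_tangent_chart`). In this
chart the second derivative of `η ∘ ψ` at 0 is the manifold Hessian `H`
(`fderiv_fderiv_comp_chart`): tangent vectors satisfy `Π w = w`, so differentiating along the fibre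
brings in `∇Π`, while the second derivative of `ψ` is purely normal and drops out. At a minimum `H`
is positive semidefinite, hence positive definite once nonsingular, and coordinates `S` with `Sᵀ H S
= 1` turn the quadratic part of `η ∘ ψ` into `‖x‖² / 2`.

The area formula (`euclideanHausdorffMeasure_image_eq_lintegral`) converts the surface integral near
`θ⋆` into a Lebesgue integral over a ball, with density `normDet (Dψ)`, whose value at 0 is `|det S|
= det H ^ (-1/2)`. On that ball `laplace_ball` compares the integrand with a Gaussian. At the
natural scale `‖x‖ ~ √τ` the first corrections, linear in the amplitude and cubic in the exponent,
have size `√τ`, but they can be taken odd in `x` and integrate to zero over a centred ball. What is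
left is of relative order `τ`.

Away from `θ⋆` the separation `δ` yields a factor `exp (-δ / τ)`, smaller than any power of `τ`
(`laplace_fibre`). The leading term is positive because `Q θ⋆ > 0` and `det H > 0`, so dividing by
it turns the absolute error into a relative one. -/

noncomputable section

namespace ConstrainedLaplace

variable {d k p : ℕ}

/-! ### Taylor remainders and odd parts. -/

section Taylor

variable {E G : Type*} [NormedAddCommGroup E] [NormedSpace ℝ E]
  [NormedAddCommGroup G] [NormedSpace ℝ G]

open Asymptotics

/-- A function vanishing at the origin whose derivative is `O(‖x‖ ^ k)` is `O(‖x‖ ^ (k + 1))`. -/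
theorem isBigO_norm_pow_succ_of_fderiv {h : E → G} {k : ℕ} (h0 : h 0 = 0)
    (hd : ∀ᶠ x in 𝓝 0, DifferentiableAt ℝ h x)
    (hO : (fun x => fderiv ℝ h x) =O[𝓝 0] fun x => ‖x‖ ^ k) :
    h =O[𝓝 0] fun x => ‖x‖ ^ (k + 1) := by
  obtain ⟨C, hC⟩ := hO.bound
  obtain ⟨ρ, hρ, hball⟩ := Metric.eventually_nhds_iff_ball.1 (hd.and hC)
  refine IsBigO.of_bound C ?_
  filter_upwards [Metric.ball_mem_nhds (0 : E) hρ] with x hx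
  have hxρ : ‖x‖ < ρ := by simpa using hx
  have hsub : ∀ z ∈ Metric.closedBall (0 : E) ‖x‖, z ∈ Metric.ball (0 : E) ρ := fun z hz => by
    simp only [Metric.mem_closedBall, dist_zero_right, Metric.mem_ball] at hz ⊢
    exact hz.trans_lt hxρ
  -- The constant of a big-O bound may be negative; the bound at a nonzero point excludes this.
  have hC0 : ‖x‖ ^ k * C ≥ 0 ∨ x = 0 := by
    by_cases hx0 : x = 0
    · exact Or.inr hx0
    · left
      have h1 := (hball x hx).2
      have h2 : 0 < ‖x‖ ^ k := pow_pos (norm_pos_iff.2 hx0) k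
      rw [Real.norm_of_nonneg h2.le] at h1
      have := (norm_nonneg _).trans h1
      linarith [mul_comm C (‖x‖ ^ k)]
  rcases hC0 with hC0 | rfl
  · have hb : ∀ z ∈ Metric.closedBall (0 : E) ‖x‖, ‖fderiv ℝ h z‖ ≤ |C| * ‖x‖ ^ k := by
      intro z hz
      have h1 := (hball z (hsub z hz)).2
      refine h1.trans ?_
      rw [norm_pow, norm_norm]
      have : ‖z‖ ≤ ‖x‖ := by simpa using hz
      gcongr
      exact le_abs_self C
    have := (convex_closedBall (0 : E) ‖x‖).norm_image_sub_le_of_norm_fderiv_le (𝕜 := ℝ)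
      (fun z hz => (hball z (hsub z hz)).1) hb (x := 0) (y := x) (by simp) (by simp)
    rw [h0, sub_zero, sub_zero] at this
    by_cases hx0 : x = 0
    · simp [hx0, h0]
    · have h2 : 0 < ‖x‖ ^ k := pow_pos (norm_pos_iff.2 hx0) k
      have hCn : 0 ≤ C := nonneg_of_mul_nonneg_right hC0 h2
      rw [abs_of_nonneg hCn] at this
      simpa [pow_succ, mul_assoc] using this
  · simp [h0]

/-- First-order Taylor expansion with quadratic remainder. -/
theorem isBigO_sub_fderiv {u : E → G} (hu : ContDiffAt ℝ 2 u 0) :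
    (fun x => u x - u 0 - fderiv ℝ u 0 x) =O[𝓝 0] fun x => ‖x‖ ^ 2 := by
  have hd : ∀ᶠ x in 𝓝 (0 : E), DifferentiableAt ℝ u x :=
    (hu.eventually (by simp)).mono fun x hx => hx.differentiableAt (by simp)
  have hder : ∀ᶠ x in 𝓝 (0 : E), HasFDerivAt (fun x => u x - u 0 - fderiv ℝ u 0 x)
      (fderiv ℝ u x - fderiv ℝ u 0) x := hd.mono fun x hx =>
    (hx.hasFDerivAt.sub_const _).sub (fderiv ℝ u 0).hasFDerivAt
  refine isBigO_norm_pow_succ_of_fderiv (k := 1) (by simp)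
    (hder.mono fun x hx => hx.differentiableAt) ?_
  have h1 : (fun x => fderiv ℝ u x - fderiv ℝ u 0) =O[𝓝 0] fun x => x - 0 :=
    ((hu.fderiv_right (m := 1) (by norm_num)).differentiableAt (by simp)).isBigO_sub
  refine (h1.congr' (hder.mono fun x hx => hx.fderiv.symm) EventuallyEq.rfl).trans ?_
  refine IsBigO.of_bound 1 (Eventually.of_forall fun x => by simp)

theorem eventually_neg {E : Type*} [NormedAddCommGroup E] {P : E → Prop} (h : ∀ᶠ x in 𝓝 0, P x) :
    ∀ᶠ x in 𝓝 (0 : E), P (-x) := by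
  have : Tendsto (fun x : E => -x) (𝓝 0) (𝓝 0) := by
    simpa using (continuous_neg (G := E)).tendsto 0
  exact this.eventually h

theorem hasFDerivAt_comp_neg {u : E → G} {x : E} (h : DifferentiableAt ℝ u (-x)) :
    HasFDerivAt (fun x => u (-x)) (-(fderiv ℝ u (-x))) x :=
  (h.hasFDerivAt.comp x (hasFDerivAt_id x).neg).congr_fderiv (by ext; simp)

/-- The odd part of a function agrees with its linear part up to a cubic remainder. -/
theorem isBigO_oddPart_sub_fderiv {u : E → G} (hu : ContDiffAt ℝ 3 u 0) :
    (fun x => (1 / 2 : ℝ) • (u x - u (-x)) - fderiv ℝ u 0 x) =O[𝓝 0] fun x => ‖x‖ ^ 3 := by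
  have hd : ∀ᶠ x in 𝓝 (0 : E), DifferentiableAt ℝ u x :=
    (hu.eventually (by simp)).mono fun x hx => hx.differentiableAt (by simp)
  have hder : ∀ᶠ x in 𝓝 (0 : E), HasFDerivAt
      (fun x => (1 / 2 : ℝ) • (u x - u (-x)) - fderiv ℝ u 0 x)
      ((1 / 2 : ℝ) • (fderiv ℝ u x + fderiv ℝ u (-x)) - fderiv ℝ u 0) x := by
    filter_upwards [hd, eventually_neg hd] with x hx hx'
    exact (((hx.hasFDerivAt.sub (hasFDerivAt_comp_neg hx')).const_smul (1 / 2 : ℝ)).sub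
      (fderiv ℝ u 0).hasFDerivAt).congr_fderiv (by rw [sub_neg_eq_add])
  refine isBigO_norm_pow_succ_of_fderiv (k := 2) (by simp)
    (hder.mono fun x hx => hx.differentiableAt) ?_
  -- The derivative of the odd part is the even part of `fderiv ℝ u`. Averaging its expansions at
  -- `x` and `-x` cancels the linear terms and leaves a quadratic remainder.
  have h1 := isBigO_sub_fderiv (hu.fderiv_right (m := 2) (by norm_num))
  have ht : Tendsto (fun x : E => -x) (𝓝 0) (𝓝 0) := by
    simpa using (continuous_neg (G := E)).tendsto 0
  have h2 := h1.comp_tendsto ht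
  have h3 : (fun x : E => ‖x‖ ^ 2) ∘ (fun x => -x) = fun x => ‖x‖ ^ 2 := by ext; simp
  rw [h3] at h2
  refine ((h1.add h2).const_smul_left (1 / 2 : ℝ)).congr' ?_ EventuallyEq.rfl
  filter_upwards [hder] with x hx
  rw [hx.fderiv]
  simp only [Function.comp, map_neg, Pi.smul_apply]
  module

/-- Around a critical point at which the Hessian is the inner product, a function is the sum of
half the squared norm, of its odd part, and of a quartic remainder. -/
theorem isBigO_sub_sq_sub_oddPart {V : Type*} [NormedAddCommGroup V] [InnerProductSpace ℝ V]
    {f : V → ℝ} (hf : ContDiffAt ℝ 4 f 0)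
    (hf'' : fderiv ℝ (fderiv ℝ f) 0 = innerSL ℝ) :
    (fun x => f x - f 0 - ‖x‖ ^ 2 / 2 - (1 / 2 : ℝ) • (f x - f (-x))) =O[𝓝 0]
      fun x => ‖x‖ ^ 4 := by
  have hd : ∀ᶠ x in 𝓝 (0 : V), DifferentiableAt ℝ f x :=
    (hf.eventually (by simp)).mono fun x hx => hx.differentiableAt (by simp)
  have hder : ∀ᶠ x in 𝓝 (0 : V), HasFDerivAt
      (fun x => f x - f 0 - ‖x‖ ^ 2 / 2 - (1 / 2 : ℝ) • (f x - f (-x)))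
      ((1 / 2 : ℝ) • (fderiv ℝ f x - fderiv ℝ f (-x)) - innerSL ℝ x) x := by
    filter_upwards [hd, eventually_neg hd] with x hx hx'
    have hsq : HasFDerivAt (fun x : V => ‖x‖ ^ 2 / 2) (innerSL ℝ x) x := by
      simp only [div_eq_inv_mul]
      exact ((hasStrictFDerivAt_norm_sq x).hasFDerivAt.const_smul (2⁻¹ : ℝ)).congr_fderiv
        (by ext z; simp)
    exact (((hx.hasFDerivAt.sub_const (f 0)).sub hsq).sub
      ((hx.hasFDerivAt.sub (hasFDerivAt_comp_neg hx')).const_smul (1 / 2 : ℝ))).congr_fderiv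
        (by ext z; simp; ring)
  refine isBigO_norm_pow_succ_of_fderiv (k := 3) (by simp)
    (hder.mono fun x hx => hx.differentiableAt) ?_
  -- Differentiating the remainder gives the odd part of `fderiv ℝ f` minus its linear part, so the
  -- cubic bound applies to `fderiv ℝ f`.
  have h1 := isBigO_oddPart_sub_fderiv (hf.fderiv_right (m := 3) (by norm_num))
  rw [hf''] at h1
  exact h1.congr' (hder.mono fun x hx => hx.fderiv.symm) EventuallyEq.rfl

end Taylor

/-! ### Laplace's method on a ball in a Euclidean space. -/

section LaplaceBall

open Real

/-- The exponential series at `X / 8` bounds the three powers by 8, 128 and 3072 times the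
exponential. Polynomial factors in the error are thus absorbed at the cost of a little Gaussian
decay. -/
theorem add_sq_add_cube_le_exp {X : ℝ} (hX : 0 ≤ X) :
    X + X ^ 2 + X ^ 3 ≤ 4000 * exp (X / 8) := by
  have h (n : ℕ) := Real.pow_div_factorial_le_exp (X / 8) (by positivity) n
  have h1 := h 1
  have h2 := h 2
  have h3 := h 3
  norm_num [Nat.factorial] at h1 h2 h3
  have := exp_pos (X / 8)
  nlinarith

theorem norm_exp_sub_sum_le_norm_mul_exp (x : ℝ) (n : ℕ) :
    |exp x - ∑ m ∈ Finset.range n, x ^ m / m.factorial| ≤ |x| ^ n * exp |x| := by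
  have := Complex.norm_exp_sub_sum_le_norm_mul_exp (x : ℂ) n
  rw [← Complex.ofReal_exp] at this
  have h2 : (Real.exp x : ℂ) - ∑ m ∈ Finset.range n, (x : ℂ) ^ m / m.factorial =
      ((exp x - ∑ m ∈ Finset.range n, x ^ m / m.factorial : ℝ) : ℂ) := by push_cast; rfl
  rwa [h2, Complex.norm_real, Complex.norm_real] at this

/-- Second-order expansion of a perturbed Gaussian density times a perturbed amplitude. -/
theorem abs_exp_mul_sub_le {X τ t c r g₀ l s A : ℝ} (hX : 0 ≤ X) (hτ : 0 ≤ τ) (hA : 0 ≤ A)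
    (htcr : t = c + r) (ht : |t| ≤ X / 4) (ht2 : t ^ 2 ≤ A * τ * X ^ 3) (hr : |r| ≤ A * τ * X ^ 2)
    (htl : |t| * |l| ≤ A * τ * X ^ 2) (hs : |s| ≤ A * τ * X) (hg : |g₀| ≤ A) :
    |exp (-(X / 2) - t) * (g₀ + l + s) - exp (-(X / 2)) * (g₀ + l - c * g₀)| ≤
      8000 * (A ^ 2 + A) * τ * exp (-(X / 8)) := by
  have e1 : |exp (-t) - 1| ≤ |t| * exp |t| := by
    have := norm_exp_sub_sum_le_norm_mul_exp (-t) 1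
    simpa using this
  have e2 : |exp (-t) - 1 + t| ≤ t ^ 2 * exp |t| := by
    have := norm_exp_sub_sum_le_norm_mul_exp (-t) 2
    simpa [Finset.sum_range_succ, sub_add_eq_sub_sub, sub_neg_eq_add] using this
  have e0 : exp (-t) ≤ exp |t| := exp_le_exp.2 (neg_le_abs t)
  have e3 : 1 ≤ exp |t| := one_le_exp (abs_nonneg t)
  -- Only the terms meant to be odd, `l` and `-c * g₀`, are kept beside `g₀`. Each of the four
  -- leftover terms is of order `τ` times a power of `X`.
  have key : exp (-(X / 2) - t) * (g₀ + l + s) - exp (-(X / 2)) * (g₀ + l - c * g₀) =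
      exp (-(X / 2)) * ((exp (-t) - 1 + t) * g₀ - r * g₀ + (exp (-t) - 1) * l + exp (-t) * s) := by
    rw [sub_eq_add_neg _ t, exp_add, htcr]; ring
  have hX3 := add_sq_add_cube_le_exp hX
  have b : |(exp (-t) - 1 + t) * g₀ - r * g₀ + (exp (-t) - 1) * l + exp (-t) * s| ≤
      exp |t| * (2 * (A ^ 2 + A) * τ * (X + X ^ 2 + X ^ 3)) := by
    have a1 : |(exp (-t) - 1 + t) * g₀| ≤ exp |t| * (A ^ 2 * τ * X ^ 3) := by
      rw [abs_mul]
      calc _ ≤ (A * τ * X ^ 3 * exp |t|) * A := by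
            refine mul_le_mul (e2.trans ?_) hg (abs_nonneg _) (by positivity)
            gcongr
        _ = _ := by ring
    have a2 : |r * g₀| ≤ exp |t| * (A ^ 2 * τ * X ^ 2) := by
      rw [abs_mul]
      calc _ ≤ (A * τ * X ^ 2) * A := mul_le_mul hr hg (abs_nonneg _) (by positivity)
        _ = 1 * (A ^ 2 * τ * X ^ 2) := by ring
        _ ≤ _ := by gcongr
    have a3 : |(exp (-t) - 1) * l| ≤ exp |t| * (A * τ * X ^ 2) := by
      rw [abs_mul]
      calc _ ≤ (|t| * exp |t|) * |l| := by gcongr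
        _ = exp |t| * (|t| * |l|) := by ring
        _ ≤ _ := by gcongr
    have a4 : |exp (-t) * s| ≤ exp |t| * (A * τ * X) := by
      rw [abs_mul, abs_of_pos (exp_pos _)]
      gcongr
    have a5 : A ^ 2 * τ * X ^ 3 + A ^ 2 * τ * X ^ 2 + A * τ * X ^ 2 + A * τ * X ≤
        2 * (A ^ 2 + A) * τ * (X + X ^ 2 + X ^ 3) := by
      have : 0 ≤ A ^ 2 * τ * X ^ 3 + A ^ 2 * τ * X ^ 2 + A * τ * X ^ 2 + A * τ * X +
        2 * A ^ 2 * τ * X + 2 * A * τ * X ^ 3 := by positivity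
      nlinarith
    calc _ ≤ _ := abs_add_le _ _
      _ ≤ |(exp (-t) - 1 + t) * g₀| + |r * g₀| + |(exp (-t) - 1) * l| + |exp (-t) * s| := by
          gcongr
          exact (abs_add_le _ _).trans (by gcongr; exact abs_sub _ _)
      _ ≤ exp |t| * (A ^ 2 * τ * X ^ 3 + A ^ 2 * τ * X ^ 2 + A * τ * X ^ 2 + A * τ * X) := by
          linarith
      _ ≤ _ := by gcongr
  rw [key, abs_mul, abs_of_pos (exp_pos _)]
  -- Decay budget: `-1/2 + 1/4 + 1/8 = -1/8`, with `1/4` spent on `exp |t|` and `1/8` on the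
  -- polynomial.
  calc _ ≤ exp (-(X / 2)) * (exp (X / 4) *
        (2 * (A ^ 2 + A) * τ * (4000 * exp (X / 8)))) := by
        gcongr
        refine b.trans ?_
        gcongr
    _ = 8000 * (A ^ 2 + A) * τ * (exp (-(X / 2)) * exp (X / 4) * exp (X / 8)) := by ring
    _ = _ := by rw [← exp_add, ← exp_add]; ring_nf

/-- The expansion of `abs_exp_mul_sub_le`, in terms of the distance `n` to the critical point. -/
theorem abs_exp_mul_sub_le_of_norm {n τ c w g₀ l s A : ℝ} (hn : 0 ≤ n) (hn1 : n ≤ 1) (hτ : 0 < τ)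
    (hA : 1 ≤ A) (hnA : A * n ≤ 1 / 8) (hc : |c| ≤ A * n ^ 3) (hw : |w| ≤ A * n ^ 4)
    (hl : |l| ≤ A * n) (hs : |s| ≤ A * n ^ 2) (hg : |g₀| ≤ A) :
    |exp (-(n ^ 2 / τ / 2) - (c + w) / τ) * (g₀ + l + s) -
      exp (-(n ^ 2 / τ / 2)) * (g₀ + l - c / τ * g₀)| ≤
      8000 * ((4 * A ^ 2) ^ 2 + 4 * A ^ 2) * τ * exp (-(n ^ 2 / τ / 8)) := by
  have hAB : A ≤ 4 * A ^ 2 := by nlinarith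
  have ht : |c + w| ≤ 2 * A * n ^ 3 := by
    refine (abs_add_le _ _).trans ((add_le_add hc hw).trans ?_)
    have : n ^ 4 ≤ n ^ 3 := pow_le_pow_of_le_one hn hn1 (by norm_num)
    nlinarith
  have hdiv : ∀ z : ℝ, |z / τ| = |z| / τ := fun z => by rw [abs_div, abs_of_pos hτ]
  -- With `X = n ^ 2 / τ`, the quantities `n ^ 2`, `n ^ 4 / τ` and `n ^ 6 / τ ^ 2` equal `τ X`, `τ X
  -- ^ 2` and `τ X ^ 3`: every error carries one factor `τ`. The constant `4 * A ^ 2` comes from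
  -- squaring `2 * A * n ^ 3`, and `A * n ≤ 1 / 8` is what gives `|t| ≤ X / 4`.
  refine abs_exp_mul_sub_le (r := w / τ) (by positivity) hτ.le (by positivity)
    (add_div c w τ) ?_ ?_ ?_ ?_ ?_ ?_
  · rw [hdiv, div_right_comm]
    gcongr
    calc |c + w| ≤ 2 * (A * n) * n ^ 2 := ht.trans (le_of_eq (by ring))
      _ ≤ 2 * (1 / 8) * n ^ 2 := by gcongr
      _ = n ^ 2 / 4 := by ring
  · rw [← sq_abs, hdiv, div_pow]
    calc _ ≤ (2 * A * n ^ 3) ^ 2 / τ ^ 2 := by gcongr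
      _ = 4 * A ^ 2 * τ * (n ^ 2 / τ) ^ 3 := by field_simp; ring
  · rw [hdiv]
    calc _ ≤ 4 * A ^ 2 * n ^ 4 / τ := by gcongr; exact hw.trans (by gcongr)
      _ = _ := by field_simp
  · rw [hdiv]
    calc _ ≤ (2 * A * n ^ 3) / τ * (A * n) := by gcongr
      _ = (2 * A ^ 2) * n ^ 4 / τ := by ring
      _ ≤ 4 * A ^ 2 * n ^ 4 / τ := by gcongr; norm_num
      _ = _ := by field_simp
  · calc _ ≤ 4 * A ^ 2 * n ^ 2 := hs.trans (by gcongr)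
      _ = _ := by field_simp
  · exact hg.trans hAB

/-- A centred Gaussian outside a ball is dominated by a wider Gaussian times its scale. -/
theorem exp_neg_sq_le_of_le {n ρ τ : ℝ} (hρ : 0 < ρ) (hn : ρ ≤ n) (hτ : 0 < τ) :
    exp (-(n ^ 2 / τ / 2)) ≤ 4000 / ρ ^ 2 * τ * exp (-(n ^ 2 / τ / 8)) := by
  set X := n ^ 2 / τ with hX
  have hX0 : 0 ≤ X := by positivity
  have h1 : 1 ≤ τ / ρ ^ 2 * X := by
    rw [hX]
    calc (1 : ℝ) ≤ n ^ 2 / ρ ^ 2 := by rw [one_le_div (by positivity)]; gcongr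
      _ = _ := by field_simp
  have h2 : X ≤ 4000 * exp (X / 8) := by
    have := add_sq_add_cube_le_exp hX0
    have : 0 ≤ X ^ 2 + X ^ 3 := by positivity
    linarith
  calc exp (-(X / 2)) ≤ exp (-(X / 2)) * (τ / ρ ^ 2 * (4000 * exp (X / 8))) := by
        refine le_mul_of_one_le_right (by positivity) (h1.trans ?_)
        gcongr
    _ = 4000 / ρ ^ 2 * τ * (exp (-(X / 2)) * exp (X / 8)) := by ring
    _ ≤ _ := by
      rw [← exp_add]
      gcongr
      linarith

variable {V : Type*} [NormedAddCommGroup V] [InnerProductSpace ℝ V] [FiniteDimensional ℝ V]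
  [MeasurableSpace V] [BorelSpace V]

theorem integrable_exp_neg_mul_sq_norm {b : ℝ} (hb : 0 < b) :
    Integrable (fun v : V => exp (-b * ‖v‖ ^ 2)) := by
  have h := (GaussianFourier.integrable_cexp_neg_mul_sq_norm_add (V := V) (b := (b : ℂ))
    (by simpa using hb) 0 0).norm
  refine h.congr (Eventually.of_forall fun v => ?_)
  simp only [Complex.norm_exp]
  congr 1
  have : (-(b : ℂ) * ((‖v‖ : ℝ) : ℂ) ^ 2) = ((-b * ‖v‖ ^ 2 : ℝ) : ℂ) := by push_cast; ring
  simp only [zero_mul, add_zero]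
  rw [this, Complex.ofReal_re]

/-- The integral of an odd function over a ball centred at the origin vanishes. -/
theorem setIntegral_ball_eq_zero_of_odd {h : V → ℝ} (hodd : ∀ x, h (-x) = -h x) (ρ : ℝ) :
    ∫ x in Metric.ball (0 : V) ρ, h x = 0 := by
  have h1 : ∫ x in Metric.ball (0 : V) ρ, h x = ∫ x in Metric.ball (0 : V) ρ, h (-x) := by
    rw [← integral_indicator measurableSet_ball, ← integral_indicator measurableSet_ball,
      ← integral_neg_eq_self]
    congr 1
    ext x
    simp [Set.indicator]
  simp only [hodd, integral_neg] at h1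
  linarith

/-- An integral over a ball is close to a Gaussian integral, once the integrand is pointwise close
to a Gaussian times the sum of a constant and of a bounded odd function. -/
theorem abs_setIntegral_ball_sub_le {J o : V → ℝ} {ρ τ a K A : ℝ} (hρ : 0 < ρ) (hτ : 0 < τ)
    (hK : 0 ≤ K) (hJ : ContinuousOn J (Metric.ball 0 ρ)) (ho : ContinuousOn o (Metric.ball 0 ρ))
    (hodd : ∀ x, o (-x) = -o x) (hbd : ∀ x ∈ Metric.ball (0 : V) ρ, |o x| ≤ A)
    (hin : ∀ x ∈ Metric.ball (0 : V) ρ, |J x - exp (-(‖x‖ ^ 2 / τ / 2)) * (a + o x)| ≤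
      K * τ * exp (-(‖x‖ ^ 2 / τ / 8))) :
    IntegrableOn J (Metric.ball 0 ρ) ∧
      |(∫ x in Metric.ball (0 : V) ρ, J x) - (2 * π * τ) ^ (Module.finrank ℝ V / 2 : ℝ) * a| ≤
        (K + 4000 / ρ ^ 2 * |a|) * (8 * π) ^ (Module.finrank ℝ V / 2 : ℝ) * τ *
          τ ^ (Module.finrank ℝ V / 2 : ℝ) := by
  set P : V → ℝ := fun x => exp (-(‖x‖ ^ 2 / τ / 2)) with hP
  have hout : ∀ x ∉ Metric.ball (0 : V) ρ, |P x * a| ≤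
      4000 / ρ ^ 2 * |a| * τ * exp (-(‖x‖ ^ 2 / τ / 8)) := by
    intro x hx
    have hxρ : ρ ≤ ‖x‖ := by simpa using hx
    rw [abs_mul, abs_of_pos (exp_pos _)]
    calc P x * |a| ≤ (4000 / ρ ^ 2 * τ * exp (-(‖x‖ ^ 2 / τ / 8))) * |a| := by
          gcongr; exact exp_neg_sq_le_of_le hρ hxρ hτ
      _ = _ := by ring
  have hPform : P = fun x => exp (-(1 / (2 * τ)) * ‖x‖ ^ 2) := by
    ext x; simp only [hP]; congr 1; field_simp
  have hPint : Integrable P := by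
    rw [hPform]; exact integrable_exp_neg_mul_sq_norm (by positivity)
  have hPtot : ∫ x, P x = (2 * π * τ) ^ (Module.finrank ℝ V / 2 : ℝ) := by
    rw [hPform, GaussianFourier.integral_rexp_neg_mul_sq_norm (by positivity)]
    congr 1; field_simp
  have hEform : (fun x : V => exp (-(‖x‖ ^ 2 / τ / 8))) =
      fun x => exp (-(1 / (8 * τ)) * ‖x‖ ^ 2) := by
    ext x; congr 1; field_simp
  have hEint : Integrable (fun x : V => exp (-(‖x‖ ^ 2 / τ / 8))) := by
    rw [hEform]; exact integrable_exp_neg_mul_sq_norm (by positivity)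
  have hEtot : ∫ x : V, exp (-(‖x‖ ^ 2 / τ / 8)) =
      (8 * π) ^ (Module.finrank ℝ V / 2 : ℝ) * τ ^ (Module.finrank ℝ V / 2 : ℝ) := by
    rw [hEform, GaussianFourier.integral_rexp_neg_mul_sq_norm (by positivity),
      ← mul_rpow (by positivity) hτ.le]
    congr 1; field_simp
  set b := Metric.ball (0 : V) ρ with hb
  have hbm : MeasurableSet b := measurableSet_ball
  have hPc : Continuous P := by fun_prop
  have hoddint : IntegrableOn (fun x => P x * o x) b := by
    refine Integrable.mono' (g := fun _ => A) (integrableOn_const (by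
      rw [hb]; exact measure_ball_lt_top.ne)) ?_ ?_
    · exact (hPc.continuousOn.mul ho).aestronglyMeasurable hbm
    · refine (ae_restrict_iff' hbm).2 (Eventually.of_forall fun x hx => ?_)
      have hP1 : P x ≤ 1 := exp_le_one_iff.2 (neg_nonpos.2 (by positivity))
      rw [Real.norm_eq_abs, abs_mul, abs_of_pos (exp_pos _)]
      exact (mul_le_of_le_one_left (abs_nonneg _) hP1).trans (hbd x hx)
  -- This cancellation by symmetry is what improves the error from `√τ` to `τ`.
  have hoddzero : ∫ x in b, P x * o x = 0 :=
    setIntegral_ball_eq_zero_of_odd (fun x => by simp only [hP, hodd, norm_neg, mul_neg]) ρ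
  have hDint : IntegrableOn (fun x => J x - P x * (a + o x)) b := by
    refine Integrable.mono' ((hEint.const_mul (K * τ)).integrableOn) ?_
      ((ae_restrict_iff' hbm).2 (Eventually.of_forall hin))
    exact (hJ.sub (hPc.continuousOn.mul (continuousOn_const.add ho))).aestronglyMeasurable hbm
  have hLint : IntegrableOn (fun x => P x * (a + o x)) b := by
    simp only [mul_add]
    exact (hPint.mul_const _).integrableOn.add hoddint
  have hJint : IntegrableOn J b := by
    refine (hDint.add hLint).congr (Eventually.of_forall fun x => ?_)
    simp
  refine ⟨hJint, ?_⟩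
  have hI1 : ∫ x in b, (J x - P x * (a + o x)) =
      (∫ x in b, J x) - ∫ x in b, P x * a := by
    rw [integral_sub hJint hLint]
    simp only [mul_add]
    rw [integral_add (hPint.mul_const _).integrableOn hoddint, hoddzero, add_zero]
  have hI2 : (∫ x in b, P x * a) + ∫ x in bᶜ, P x * a =
      (2 * π * τ) ^ (Module.finrank ℝ V / 2 : ℝ) * a := by
    rw [integral_add_compl hbm (hPint.mul_const _), integral_mul_const, hPtot]
  -- The total error is the pointwise error inside the ball minus the Gaussian mass outside it.
  have hI3 : (∫ x in b, J x) - (2 * π * τ) ^ (Module.finrank ℝ V / 2 : ℝ) * a =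
      (∫ x in b, (J x - P x * (a + o x))) - ∫ x in bᶜ, P x * a := by
    rw [hI1, ← hI2]; ring
  have hE0 : ∀ x : V, 0 ≤ exp (-(‖x‖ ^ 2 / τ / 8)) := fun x => (exp_pos _).le
  have hI4 : |∫ x in b, (J x - P x * (a + o x))| ≤
      K * τ * ∫ x : V, exp (-(‖x‖ ^ 2 / τ / 8)) := by
    have := norm_integral_le_of_norm_le
      (f := fun x => J x - P x * (a + o x)) ((hEint.const_mul (K * τ)).integrableOn
      (s := b)) ((ae_restrict_iff' hbm).2 (Eventually.of_forall hin))
    refine this.trans ?_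
    rw [integral_const_mul]
    refine mul_le_mul_of_nonneg_left ?_ (by positivity)
    exact setIntegral_le_integral hEint (Eventually.of_forall hE0)
  have hI5 : |∫ x in bᶜ, P x * a| ≤
      4000 / ρ ^ 2 * |a| * τ * ∫ x : V, exp (-(‖x‖ ^ 2 / τ / 8)) := by
    have := norm_integral_le_of_norm_le (f := fun x => P x * a)
      ((hEint.const_mul (4000 / ρ ^ 2 * |a| * τ)).integrableOn (s := bᶜ))
      ((ae_restrict_iff' hbm.compl).2 (Eventually.of_forall hout))
    refine this.trans ?_
    rw [integral_const_mul]
    refine mul_le_mul_of_nonneg_left ?_ (by positivity)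
    exact setIntegral_le_integral hEint (Eventually.of_forall hE0)
  rw [hI3]
  refine (abs_sub _ _).trans ((add_le_add hI4 hI5).trans (le_of_eq ?_))
  rw [hEtot]
  ring

/-- Laplace's method on a small ball, at a minimum where the Hessian is the inner product. -/
theorem laplace_ball {f g : V → ℝ} (hf : ContDiffAt ℝ 4 f 0) (hg : ContDiffAt ℝ 2 g 0)
    (hf' : fderiv ℝ f 0 = 0) (hf'' : fderiv ℝ (fderiv ℝ f) 0 = innerSL ℝ) :
    ∀ᶠ ρ in 𝓝[>] (0 : ℝ), ∃ K : ℝ, ∀ τ > 0,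
      IntegrableOn (fun x => exp (-(1 / τ) * (f x - f 0)) * g x) (Metric.ball 0 ρ) ∧
      |(∫ x in Metric.ball (0 : V) ρ, exp (-(1 / τ) * (f x - f 0)) * g x) -
        (2 * π * τ) ^ (Module.finrank ℝ V / 2 : ℝ) * g 0| ≤
        K * τ * τ ^ (Module.finrank ℝ V / 2 : ℝ) := by
  set c : V → ℝ := fun x => (1 / 2 : ℝ) • (f x - f (-x)) with hc
  have hcodd : ∀ x, c (-x) = -c x := fun x => by simp [hc]; ring
  obtain ⟨C₁, hC₁⟩ := (isBigO_oddPart_sub_fderiv (hf.of_le (by norm_num))).bound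
  obtain ⟨C₂, hC₂⟩ := (isBigO_sub_sq_sub_oddPart hf hf'').bound
  obtain ⟨C₃, hC₃⟩ := (isBigO_sub_fderiv hg).bound
  have hfc : ∀ᶠ x in 𝓝 (0 : V), ContinuousAt f x :=
    (hf.eventually (by simp)).mono fun x hx => hx.continuousAt
  have hgc : ∀ᶠ x in 𝓝 (0 : V), ContinuousAt g x :=
    (hg.eventually (by simp)).mono fun x hx => hx.continuousAt
  obtain ⟨ρ₁, hρ₁, hball⟩ := Metric.eventually_nhds_iff_ball.1
    (((hC₁.and hC₂).and hC₃).and ((hfc.and (eventually_neg hfc)).and hgc))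
  set l := fderiv ℝ g 0 with hl
  set A : ℝ := |C₁| + |C₂| + |C₃| + ‖l‖ + |g 0| + 1 with hA
  have p1 := abs_nonneg C₁
  have p2 := abs_nonneg C₂
  have p3 := abs_nonneg C₃
  have p4 := norm_nonneg l
  have p5 := abs_nonneg (g 0)
  have hA1 : 1 ≤ A := by linarith
  -- Inside `ρ₁` the Taylor bounds hold, radius at most 1 orders the powers of `‖x‖`, and `1 / (8 *
  -- A)` keeps the perturbation of the exponent below half the quadratic part.
  have hρ₂ : (0 : ℝ) < min ρ₁ (min 1 (1 / (8 * A))) := by positivity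
  filter_upwards [Ioo_mem_nhdsGT hρ₂] with ρ hρ
  have hρ0 : 0 < ρ := hρ.1
  have hρρ₁ : ρ ≤ ρ₁ := (hρ.2.trans_le (min_le_left _ _)).le
  have hρ1 : ρ ≤ 1 := (hρ.2.trans_le ((min_le_right _ _).trans (min_le_left _ _))).le
  have hρA : A * ρ ≤ 1 / 8 := by
    have := (hρ.2.trans_le ((min_le_right _ _).trans (min_le_right _ _))).le
    calc A * ρ ≤ A * (1 / (8 * A)) := by gcongr
      _ = 1 / 8 := by field_simp
  refine ⟨(8000 * ((4 * A ^ 2) ^ 2 + 4 * A ^ 2) + 4000 / ρ ^ 2 * |g 0|) *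
    (8 * π) ^ (Module.finrank ℝ V / 2 : ℝ), fun τ hτ => ?_⟩
  -- The second bound degenerates as `τ → 0`, harmlessly: it serves only the integrability of the
  -- odd term and does not enter the final constant.
  have hin : ∀ x ∈ Metric.ball (0 : V) ρ,
      |exp (-(1 / τ) * (f x - f 0)) * g x -
        exp (-(‖x‖ ^ 2 / τ / 2)) * (g 0 + (l x - c x / τ * g 0))| ≤
        8000 * ((4 * A ^ 2) ^ 2 + 4 * A ^ 2) * τ * exp (-(‖x‖ ^ 2 / τ / 8)) ∧
        |l x - c x / τ * g 0| ≤ A + A / τ * |g 0| := by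
    intro x hx
    obtain ⟨⟨⟨b1, b2⟩, b3⟩, -⟩ := hball x (Metric.ball_subset_ball hρρ₁ hx)
    have hxρ : ‖x‖ < ρ := by simpa using hx
    have hn := norm_nonneg x
    rw [hf', _root_.zero_apply, sub_zero] at b1
    simp only [norm_pow, norm_norm] at b1 b2 b3
    change |c x| ≤ _ at b1
    change |f x - f 0 - ‖x‖ ^ 2 / 2 - c x| ≤ _ at b2
    change |g x - g 0 - l x| ≤ _ at b3
    have b1' : |c x| ≤ A * ‖x‖ ^ 3 := b1.trans (by gcongr; linarith [le_abs_self C₁])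
    have b2' : |f x - f 0 - ‖x‖ ^ 2 / 2 - c x| ≤ A * ‖x‖ ^ 4 :=
      b2.trans (by gcongr; linarith [le_abs_self C₂])
    have b3' : |g x - g 0 - l x| ≤ A * ‖x‖ ^ 2 := b3.trans (by gcongr; linarith [le_abs_self C₃])
    have b4 : |l x| ≤ A * ‖x‖ := (l.le_opNorm x).trans (by gcongr; linarith)
    have hx1 : ‖x‖ ≤ 1 := hxρ.le.trans hρ1
    constructor
    · have main := abs_exp_mul_sub_le_of_norm hn hx1 hτ hA1
        ((by gcongr : A * ‖x‖ ≤ A * ρ).trans hρA) b1' b2' b4 b3' (by linarith : |g 0| ≤ A)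
      convert main using 2
      congr 1
      · congr 2
        · field_simp
          ring
        · ring
      · ring
    · calc |l x - c x / τ * g 0| ≤ |l x| + |c x| / τ * |g 0| := by
            refine (abs_sub _ _).trans (le_of_eq ?_)
            rw [abs_mul, abs_div, abs_of_pos hτ]
        _ ≤ (A * 1) + (A * 1) / τ * |g 0| := by
            gcongr
            · exact b4.trans (by gcongr)
            · exact b1'.trans (by gcongr; exact pow_le_one₀ hn hx1)
        _ = _ := by ring
  have hsub := Metric.ball_subset_ball (x := (0 : V)) hρρ₁
  have hfb : ContinuousOn f (Metric.ball 0 ρ) := fun x hx =>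
    (hball x (hsub hx)).2.1.1.continuousWithinAt
  have hfb' : ContinuousOn (fun x => f (-x)) (Metric.ball 0 ρ) := fun x hx =>
    ((hball x (hsub hx)).2.1.2.comp (continuous_neg.continuousAt (x := x))).continuousWithinAt
  have hgb : ContinuousOn g (Metric.ball 0 ρ) := fun x hx =>
    (hball x (hsub hx)).2.2.continuousWithinAt
  have hcb : ContinuousOn c (Metric.ball 0 ρ) := (hfb.sub hfb').const_smul (1 / 2 : ℝ)
  refine abs_setIntegral_ball_sub_le (o := fun x => l x - c x / τ * g 0) hρ0 hτ (by positivity)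
    ((Real.continuous_exp.comp_continuousOn
      (continuousOn_const.mul (hfb.sub continuousOn_const))).mul hgb)
    (l.continuous.continuousOn.sub ((hcb.div_const τ).mul_const (g 0)))
    (fun x => by simp only [hcodd, map_neg]; ring) (fun x hx => (hin x hx).2)
    (fun x hx => (hin x hx).1)

end LaplaceBall

/-! ### The area formula for injective immersions. -/

section AreaFormula

open scoped ENNReal NNReal
open Module Measure

/-- Images of a set under two maps with comparable distances have comparable Hausdorff measures. -/
theorem euclideanHausdorffMeasure_image_le_of_dist_le {α X Y : Type*}
    [MetricSpace X] [MeasurableSpace X] [BorelSpace X]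
    [MetricSpace Y] [MeasurableSpace Y] [BorelSpace Y] {f : α → X} {g : α → Y} {s : Set α} {K : ℝ}
    (hK : 0 ≤ K) (h : ∀ u ∈ s, ∀ v ∈ s, dist (f u) (f v) ≤ K * dist (g u) (g v)) (p : ℕ) :
    (euclideanHausdorffMeasure p : Measure X) (f '' s) ≤
      ENNReal.ofReal K ^ p * (euclideanHausdorffMeasure p : Measure Y) (g '' s) := by
  lift K to ℝ≥0 using hK
  rw [ENNReal.ofReal_coe_nnreal]
  rcases s.eq_empty_or_nonempty with rfl | ⟨a, ha⟩
  · simp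
  have : Nonempty α := ⟨a⟩
  have hmem : ∀ u ∈ s, Function.invFunOn g s (g u) ∈ s ∧ g (Function.invFunOn g s (g u)) = g u :=
    fun u hu => ⟨Function.invFunOn_mem ⟨u, hu, rfl⟩, Function.invFunOn_eq ⟨u, hu, rfl⟩⟩
  -- Points with equal `g`-value have equal `f`-value, so `f` factors on `s` through a `K`-Lipschitz
  -- map of `g '' s`, whatever preimages are chosen.
  have hL : LipschitzOnWith K (f ∘ Function.invFunOn g s) (g '' s) := by
    refine LipschitzOnWith.of_dist_le_mul ?_
    rintro _ ⟨u, hu, rfl⟩ _ ⟨v, hv, rfl⟩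
    have := h _ (hmem u hu).1 _ (hmem v hv).1
    rwa [(hmem u hu).2, (hmem v hv).2] at this
  have himg : (f ∘ Function.invFunOn g s) '' (g '' s) = f '' s := by
    rw [Set.image_image]
    refine Set.image_congr fun u hu => ?_
    have := h _ (hmem u hu).1 _ hu
    rw [(hmem u hu).2, dist_self, mul_zero] at this
    exact dist_le_zero.1 this
  have key := hL.hausdorffMeasure_image_le (d := p) (by positivity)
  rw [himg, ENNReal.rpow_natCast] at key
  rw [euclideanHausdorffMeasure_def, euclideanHausdorffMeasure_def]
  simp only [Measure.smul_apply, nnreal_smul_coe_apply]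
  rw [mul_left_comm]
  gcongr

/-- A measure inequality that holds locally on `s` holds on `s`. -/
theorem measure_le_mul_of_locally {X : Type*} [TopologicalSpace X] [SecondCountableTopology X]
    [MeasurableSpace X] [OpensMeasurableSpace X] {μ ν : Measure X} {s : Set X} {c : ℝ≥0∞}
    (h : ∀ x ∈ s, ∃ N ∈ 𝓝 x, ∀ S, MeasurableSet S → S ⊆ N ∩ s → ν S ≤ c * μ S)
    {S : Set X} (hS : MeasurableSet S) (hSs : S ⊆ s) : ν S ≤ c * μ S := by
  rcases s.eq_empty_or_nonempty with rfl | hne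
  · rw [Set.subset_empty_iff.1 hSs]; simp
  have h' : ∀ x, ∃ N : Set X, IsOpen N ∧ (x ∈ s → x ∈ N) ∧
      ∀ S, MeasurableSet S → S ⊆ N ∩ s → ν S ≤ c * μ S := by
    intro x
    by_cases hx : x ∈ s
    · obtain ⟨N, hN, hN'⟩ := h x hx
      obtain ⟨O, hO, hOo, hxO⟩ := mem_nhds_iff.1 hN
      exact ⟨O, hOo, fun _ => hxO, fun S hS hSO =>
        hN' S hS (hSO.trans (Set.inter_subset_inter_left _ hO))⟩
    · refine ⟨∅, isOpen_empty, fun hx' => (hx hx').elim, fun S _ hS => ?_⟩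
      rw [Set.empty_inter, Set.subset_empty_iff] at hS
      simp [hS]
  choose N hNo hxN hN using h'
  -- A countable subcover, made disjoint, lets countable additivity sum the local inequalities with
  -- the same constant.
  obtain ⟨t, hts, htc, hcov⟩ := TopologicalSpace.countable_cover_nhdsWithin (s := s) (f := N)
    fun x hx => mem_nhdsWithin_of_mem_nhds ((hNo x).mem_nhds (hxN x hx))
  have htne : t.Nonempty := by
    by_contra ht
    rw [Set.not_nonempty_iff_eq_empty] at ht
    obtain ⟨x, hx⟩ := hne
    simpa [ht] using hcov hx
  obtain ⟨e, rfl⟩ := htc.exists_eq_range htne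
  set D := disjointed fun i => N (e i) with hD
  have hDm : ∀ i, MeasurableSet (D i) :=
    fun i => MeasurableSet.disjointed (fun i => (hNo (e i)).measurableSet) i
  have hSD : S = ⋃ i, S ∩ D i := by
    rw [← Set.inter_iUnion, hD, iUnion_disjointed, eq_comm, Set.inter_eq_left]
    refine hSs.trans (hcov.trans ?_)
    simp
  have hdisj : Pairwise (Function.onFun Disjoint fun i => S ∩ D i) := fun i j hij =>
    (disjoint_disjointed _ hij).mono Set.inter_subset_right Set.inter_subset_right
  rw [hSD, measure_iUnion hdisj fun i => hS.inter (hDm i),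
    measure_iUnion hdisj fun i => hS.inter (hDm i), ← ENNReal.tsum_mul_left]
  refine ENNReal.tsum_le_tsum fun i => hN (e i) _ (hS.inter (hDm i)) fun x hx => ⟨?_, hSs hx.1⟩
  exact disjointed_subset _ i hx.2

/-- The measure `S ↦ μHE[dim E] (φ '' (S ∩ s))`. -/
def imageMeasure {E V : Type*} [NormedAddCommGroup E] [NormedSpace ℝ E] [MeasurableSpace E]
    [MetricSpace V] [MeasurableSpace V] [BorelSpace V] (φ : E → V) (s : Set E) : Measure E :=
  ((euclideanHausdorffMeasure (finrank ℝ E) : Measure V).comap (s.domRestrict φ)).map Subtype.val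

theorem imageMeasure_apply {E V : Type*} [NormedAddCommGroup E] [NormedSpace ℝ E]
    [MeasurableSpace E] [MetricSpace V] [MeasurableSpace V] [BorelSpace V] {φ : E → V} {s S : Set E}
    (hφ : MeasurableEmbedding (s.domRestrict φ)) (hS : MeasurableSet S) (hSs : S ⊆ s) :
    imageMeasure φ s S = euclideanHausdorffMeasure (finrank ℝ E) (φ '' S) := by
  rw [imageMeasure, Measure.map_apply measurable_subtype_coe hS, hφ.comap_apply]
  congr 1
  ext y
  constructor
  · rintro ⟨⟨x, hx⟩, hxS, rfl⟩
    exact ⟨x, hxS, rfl⟩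
  · rintro ⟨x, hxS, rfl⟩
    exact ⟨⟨x, hSs hxS⟩, hxS, rfl⟩

variable {E V : Type*} [NormedAddCommGroup E] [InnerProductSpace ℝ E] [FiniteDimensional ℝ E]
  [NormedAddCommGroup V] [InnerProductSpace ℝ V]

/-- The norm determinant is the square root of `det (A† A)`, and adjoint, composition and
determinant are continuous. -/
theorem continuous_normDet [CompleteSpace V] :
    Continuous fun A : E →L[ℝ] V => LinearMap.normDet (A : E →ₗ[ℝ] V) := by
  have : CompleteSpace E := FiniteDimensional.complete ℝ E
  have h : (fun A : E →L[ℝ] V => LinearMap.normDet (A : E →ₗ[ℝ] V)) =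
      fun A => √((ContinuousLinearMap.adjoint A ∘L A).det) := by
    ext A
    rw [← A.normDet_sq]
    simp [Real.sqrt_sq (LinearMap.normDet_nonneg _)]
  rw [h]
  refine Real.continuous_sqrt.comp (ContinuousLinearMap.continuous_det.comp ?_)
  exact (ContinuousLinearMap.adjoint (𝕜 := ℝ) (E := E) (F := V)).continuous.clm_comp continuous_id

/-- Near a point with injective strict derivative `A`, distances are nearly those under `A`. -/
theorem eventually_dist_le_of_hasStrictFDerivAt {φ : E → V} {A : E →L[ℝ] V} {x : E}
    (hφ : HasStrictFDerivAt φ A x) (hA : Function.Injective A) {ε : ℝ} (hε : 0 < ε) :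
    ∃ N ∈ 𝓝 x, ∀ u ∈ N, ∀ v ∈ N, dist (φ u) (φ v) ≤ (1 + ε) * dist (A u) (A v) ∧
      (1 - ε) * dist (A u) (A v) ≤ dist (φ u) (φ v) := by
  obtain ⟨K, hK, hanti⟩ := (A : E →ₗ[ℝ] V).exists_antilipschitzWith (LinearMap.ker_eq_bot.2 hA)
  have hKpos : (0 : ℝ) < K := hK
  -- Since `A` is bounded below by `1 / K`, linearization error `ε / K` relative to `‖u - v‖`
  -- becomes error `ε` relative to `‖A (u - v)‖`.
  obtain ⟨N, hN, hNA⟩ := hφ.approximates_deriv_on_nhds (c := Real.toNNReal (ε / K))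
    (Or.inr (Real.toNNReal_pos.2 (div_pos hε hKpos)))
  refine ⟨N, hN, fun u hu v hv => ?_⟩
  have h1 : ‖φ u - φ v - A (u - v)‖ ≤ ε / K * ‖u - v‖ := by
    have := hNA u hu v hv
    rwa [Real.coe_toNNReal _ (by positivity)] at this
  have h2 : ‖u - v‖ ≤ K * ‖A (u - v)‖ := by
    have := hanti.le_mul_dist u v
    simpa [dist_eq_norm] using this
  have h3 : ‖φ u - φ v - A (u - v)‖ ≤ ε * ‖A (u - v)‖ := by
    calc _ ≤ ε / K * (K * ‖A (u - v)‖) := h1.trans (by gcongr)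
      _ = _ := by field_simp
  have h4 := norm_sub_norm_le (φ u - φ v) (A (u - v))
  have h5 := norm_sub_norm_le (A (u - v)) (φ u - φ v)
  rw [norm_sub_rev (A (u - v)) (φ u - φ v)] at h5
  rw [dist_eq_norm, dist_eq_norm, ← map_sub]
  constructor <;> linarith

variable [MeasurableSpace E] [BorelSpace E]

theorem aemeasurable_toNNReal_normDet [CompleteSpace V] {φ' : E → E →L[ℝ] V} {s : Set E}
    (hs : MeasurableSet s) (hcont : ∀ x ∈ s, ContinuousAt φ' x) :
    AEMeasurable (fun x => (LinearMap.normDet (φ' x : E →ₗ[ℝ] V)).toNNReal)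
      (volume.restrict s) := by
  refine AEMeasurable.real_toNNReal (ContinuousOn.aemeasurable ?_ hs)
  exact continuous_normDet.comp_continuousOn fun x hx => (hcont x hx).continuousWithinAt

variable [MeasurableSpace V] [BorelSpace V] [FiniteDimensional ℝ V]

/-- **Area formula** for injective immersions: the Hausdorff measure of the image of a set is the
integral of the norm determinant of the derivative. -/
theorem euclideanHausdorffMeasure_image_eq_lintegral {φ : E → V} {φ' : E → E →L[ℝ] V} {s : Set E}
    (hs : MeasurableSet s) (hφ : ∀ x ∈ s, HasStrictFDerivAt φ (φ' x) x)
    (hcont : ∀ x ∈ s, ContinuousAt φ' x) (hinj : Set.InjOn φ s)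
    (himm : ∀ x ∈ s, Function.Injective (φ' x)) {S : Set E} (hS : MeasurableSet S) (hSs : S ⊆ s) :
    euclideanHausdorffMeasure (finrank ℝ E) (φ '' S) =
      ∫⁻ x in S, ENNReal.ofReal (LinearMap.normDet (φ' x : E →ₗ[ℝ] V)) := by
  set J : E → ℝ := fun x => LinearMap.normDet (φ' x : E →ₗ[ℝ] V) with hJ
  set p := finrank ℝ E with hp
  have hemb : MeasurableEmbedding (s.domRestrict φ) := ContinuousOn.measurableEmbedding hs
    (fun x hx => (hφ x hx).hasFDerivAt.continuousAt.continuousWithinAt) hinj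
  have hJc : ∀ x ∈ s, ContinuousAt J x := fun x hx =>
    continuous_normDet.continuousAt.comp (hcont x hx)
  have hJpos : ∀ x ∈ s, 0 < J x := fun x hx =>
    lt_of_le_of_ne (LinearMap.normDet_nonneg _)
      (Ne.symm (((φ' x : E →ₗ[ℝ] V).normDet_ne_zero_tfae.out 4 0).1 (himm x hx)))
  set μ₂ : Measure E := (volume : Measure E).withDensity fun x => ENNReal.ofReal (J x) with hμ₂
  have hμ₂a : ∀ T, MeasurableSet T → μ₂ T = ∫⁻ x in T, ENNReal.ofReal (J x) :=
    fun T hT => withDensity_apply _ hT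
  -- Of the `p + 1` powers, `p` come from distorting distances in a `p`-dimensional measure and one
  -- from the oscillation of the density `J`.
  have hloc : ∀ ε ∈ Set.Ioo (0 : ℝ) 1, ∀ x ∈ s, ∃ N ∈ 𝓝 x, ∀ T, MeasurableSet T → T ⊆ N ∩ s →
      imageMeasure φ s T ≤ ENNReal.ofReal ((1 + ε) ^ (p + 1)) * μ₂ T ∧
      μ₂ T ≤ ENNReal.ofReal (((1 - ε) ^ (p + 1))⁻¹) * imageMeasure φ s T := by
    rintro ε ⟨hε, hε1⟩ x hx
    obtain ⟨N, hN, hNd⟩ := eventually_dist_le_of_hasStrictFDerivAt (hφ x hx) (himm x hx) hε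
    have h1ε : 0 < 1 - ε := by linarith
    have hJx := hJpos x hx
    have hnear : ∀ᶠ z in 𝓝 x, J x < (1 + ε) * J z ∧ (1 - ε) * J z < J x := by
      refine (Tendsto.eventually_const_lt ?_ ((hJc x hx).const_mul (1 + ε))).and
        (Tendsto.eventually_lt_const ?_ ((hJc x hx).const_mul (1 - ε)))
      · nlinarith
      · nlinarith
    refine ⟨_, inter_mem hN hnear, fun T hT hTN => ?_⟩
    have hlin := LinearMap.euclideanHausdorffMeasure_image_eq_normDet_mul_volume
      (φ' x : E →ₗ[ℝ] V) T
    rw [imageMeasure_apply hemb hT (fun z hz => (hTN hz).2), hμ₂a T hT]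
    have hTvol : ∫⁻ z in T, ENNReal.ofReal (J x) = ENNReal.ofReal (J x) * volume T := by
      rw [setLIntegral_const]
    rw [← hp, ← hTvol] at hlin
    constructor
    · have h1 := euclideanHausdorffMeasure_image_le_of_dist_le (s := T) (f := φ)
        (g := (φ' x : E →ₗ[ℝ] V)) (K := 1 + ε) (by positivity)
        (fun u hu v hv => (hNd u (hTN hu).1.1 v (hTN hv).1.1).1) p
      refine h1.trans ?_
      rw [hlin]
      rw [ENNReal.ofReal_pow (by positivity), pow_succ, mul_assoc]
      gcongr
      rw [← lintegral_const_mul' _ _ ENNReal.ofReal_ne_top]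
      refine setLIntegral_mono' hT fun z hz => ?_
      rw [← ENNReal.ofReal_mul (by positivity)]
      exact ENNReal.ofReal_le_ofReal (hTN hz).1.2.1.le
    · have h1 := euclideanHausdorffMeasure_image_le_of_dist_le (s := T) (f := (φ' x : E →ₗ[ℝ] V))
        (g := φ) (K := (1 - ε)⁻¹) (by positivity)
        (fun u hu v hv => by
          have := (hNd u (hTN hu).1.1 v (hTN hv).1.1).2
          change dist (φ' x u) (φ' x v) ≤ (1 - ε)⁻¹ * _
          rwa [le_inv_mul_iff₀ h1ε]) p
      rw [hlin] at h1
      rw [← inv_pow, ENNReal.ofReal_pow (by positivity), pow_succ', mul_assoc]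
      refine le_trans ?_ (mul_le_mul_right h1 _)
      rw [← lintegral_const_mul' _ _ ENNReal.ofReal_ne_top]
      refine setLIntegral_mono' hT fun z hz => ?_
      rw [← ENNReal.ofReal_mul (by positivity)]
      refine ENNReal.ofReal_le_ofReal ?_
      rw [le_inv_mul_iff₀ h1ε]
      exact (hTN hz).1.2.2.le
  rw [← hμ₂a S hS, ← imageMeasure_apply hemb hS hSs]
  -- Both comparison constants tend to 1 as `ε → 0`.
  have hIoo : ∀ᶠ ε in 𝓝[>] (0 : ℝ), ε ∈ Set.Ioo (0 : ℝ) 1 := Ioo_mem_nhdsGT one_pos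
  refine le_antisymm ?_ ?_
  · have hlim : Tendsto (fun ε : ℝ => ENNReal.ofReal ((1 + ε) ^ (p + 1)) * μ₂ S) (𝓝[>] 0)
        (𝓝 (1 * μ₂ S)) := by
      refine ENNReal.Tendsto.mul_const ?_ (Or.inl one_ne_zero)
      have : Tendsto (fun ε : ℝ => (1 + ε) ^ (p + 1)) (𝓝[>] 0) (𝓝 ((1 + 0) ^ (p + 1))) :=
        ((by fun_prop : Continuous fun ε : ℝ => (1 + ε) ^ (p + 1)).tendsto 0).mono_left
          nhdsWithin_le_nhds
      simpa using ENNReal.tendsto_ofReal this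
    rw [one_mul] at hlim
    refine ge_of_tendsto hlim (hIoo.mono fun ε hε => ?_)
    refine measure_le_mul_of_locally (fun x hx => ?_) hS hSs
    obtain ⟨N, hN, h⟩ := hloc ε hε x hx
    exact ⟨N, hN, fun T hT hTN => (h T hT hTN).1⟩
  · have hlim : Tendsto (fun ε : ℝ => ENNReal.ofReal (((1 - ε) ^ (p + 1))⁻¹) *
        imageMeasure φ s S) (𝓝[>] 0) (𝓝 (1 * imageMeasure φ s S)) := by
      refine ENNReal.Tendsto.mul_const ?_ (Or.inl one_ne_zero)
      have h1 : ContinuousAt (fun ε : ℝ => ((1 - ε) ^ (p + 1))⁻¹) 0 :=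
        ContinuousAt.inv₀ (by fun_prop) (by simp)
      have : Tendsto (fun ε : ℝ => ((1 - ε) ^ (p + 1))⁻¹) (𝓝[>] 0) (𝓝 ((1 - 0) ^ (p + 1))⁻¹) :=
        h1.tendsto.mono_left nhdsWithin_le_nhds
      simpa using ENNReal.tendsto_ofReal this
    rw [one_mul] at hlim
    refine ge_of_tendsto hlim (hIoo.mono fun ε hε => ?_)
    refine measure_le_mul_of_locally (fun x hx => ?_) hS hSs
    obtain ⟨N, hN, h⟩ := hloc ε hε x hx
    exact ⟨N, hN, fun T hT hTN => (h T hT hTN).2⟩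

/-- The Hausdorff measure on the image of an injective immersion is the push-forward of a density
with respect to Lebesgue measure. -/
theorem map_withDensity_normDet_eq_euclideanHausdorffMeasure {φ : E → V} {φ' : E → E →L[ℝ] V}
    {s : Set E}
    (hs : MeasurableSet s) (hφ : ∀ x ∈ s, HasStrictFDerivAt φ (φ' x) x)
    (hcont : ∀ x ∈ s, ContinuousAt φ' x) (hinj : Set.InjOn φ s)
    (himm : ∀ x ∈ s, Function.Injective (φ' x)) :
    Measure.map (s.domRestrict φ) (comap Subtype.val ((volume : Measure E).withDensity
        fun x => ENNReal.ofReal (LinearMap.normDet (φ' x : E →ₗ[ℝ] V)))) =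
      (euclideanHausdorffMeasure (finrank ℝ E)).restrict (φ '' s) := by
  have hemb : MeasurableEmbedding (s.domRestrict φ) := ContinuousOn.measurableEmbedding hs
    (fun x hx => (hφ x hx).hasFDerivAt.continuousAt.continuousWithinAt) hinj
  have hval := MeasurableEmbedding.subtype_coe hs
  ext T hT
  have himg : MeasurableSet (Subtype.val '' (s.domRestrict φ ⁻¹' T)) :=
    hval.measurableSet_image.2 (hemb.measurable hT)
  rw [Measure.map_apply hemb.measurable hT, hval.comap_apply, Measure.restrict_apply hT,
    withDensity_apply _ himg, ← euclideanHausdorffMeasure_image_eq_lintegral hs hφ hcont hinj himm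
      himg (by rintro _ ⟨x, -, rfl⟩; exact x.2)]
  congr 1
  ext y
  constructor
  · rintro ⟨_, ⟨x, hxT, rfl⟩, rfl⟩
    exact ⟨hxT, x, x.2, rfl⟩
  · rintro ⟨hyT, x, hx, rfl⟩
    exact ⟨x, ⟨⟨x, hx⟩, hyT, rfl⟩, rfl⟩

/-- Change of variables for integrability on the image of an injective immersion. -/
theorem integrableOn_image_iff_integrableOn_normDet_smul {φ : E → V} {φ' : E → E →L[ℝ] V}
    {s : Set E}
    (hs : MeasurableSet s) (hφ : ∀ x ∈ s, HasStrictFDerivAt φ (φ' x) x)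
    (hcont : ∀ x ∈ s, ContinuousAt φ' x) (hinj : Set.InjOn φ s)
    (himm : ∀ x ∈ s, Function.Injective (φ' x)) (h : V → ℝ) :
    IntegrableOn h (φ '' s) (euclideanHausdorffMeasure (finrank ℝ E)) ↔
      IntegrableOn (fun x => LinearMap.normDet (φ' x : E →ₗ[ℝ] V) • h (φ x)) s := by
  have hemb : MeasurableEmbedding (s.domRestrict φ) := ContinuousOn.measurableEmbedding hs
    (fun x hx => (hφ x hx).hasFDerivAt.continuousAt.continuousWithinAt) hinj
  rw [IntegrableOn, ← map_withDensity_normDet_eq_euclideanHausdorffMeasure hs hφ hcont hinj himm,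
    hemb.integrable_map_iff]
  simp only [Set.domRestrict_eq, ← Function.comp_assoc, ENNReal.ofReal]
  rw [← (MeasurableEmbedding.subtype_coe hs).integrable_map_iff, map_comap_subtype_coe hs,
    restrict_withDensity hs, integrable_withDensity_iff_integrable_coe_smul₀]
  · simp_rw [IntegrableOn, Real.coe_toNNReal _ (LinearMap.normDet_nonneg _), Function.comp_apply]
  · exact aemeasurable_toNNReal_normDet hs hcont

/-- Change of variables for integrals over the image of an injective immersion. -/
theorem integral_image_eq_integral_normDet_smul {φ : E → V} {φ' : E → E →L[ℝ] V} {s : Set E}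
    (hs : MeasurableSet s) (hφ : ∀ x ∈ s, HasStrictFDerivAt φ (φ' x) x)
    (hcont : ∀ x ∈ s, ContinuousAt φ' x) (hinj : Set.InjOn φ s)
    (himm : ∀ x ∈ s, Function.Injective (φ' x)) (h : V → ℝ) :
    ∫ z in φ '' s, h z ∂(euclideanHausdorffMeasure (finrank ℝ E)) =
      ∫ x in s, LinearMap.normDet (φ' x : E →ₗ[ℝ] V) • h (φ x) := by
  have hemb : MeasurableEmbedding (s.domRestrict φ) := ContinuousOn.measurableEmbedding hs
    (fun x hx => (hφ x hx).hasFDerivAt.continuousAt.continuousWithinAt) hinj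
  rw [← map_withDensity_normDet_eq_euclideanHausdorffMeasure hs hφ hcont hinj himm,
    hemb.integral_map]
  simp only [Set.domRestrict_apply, ← Function.comp_apply (f := h), ENNReal.ofReal]
  rw [← (MeasurableEmbedding.subtype_coe hs).integral_map, map_comap_subtype_coe hs,
    setIntegral_withDensity_eq_setIntegral_smul₀ (aemeasurable_toNNReal_normDet hs hcont) _ hs]
  congr with x
  rw [NNReal.smul_def, Real.coe_toNNReal _ (LinearMap.normDet_nonneg _)]

end AreaFormula

/-! ### Smoothness of determinants and inverses. -/

section MatrixSmoothness

variable {E : Type*} [NormedAddCommGroup E] [NormedSpace ℝ E] {ι κ : Type*} [Fintype ι]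
  [DecidableEq ι] {N : WithTop ℕ∞} {x : E}

theorem contDiffAt_det {A : E → Matrix ι ι ℝ}
    (hA : ∀ i j, ContDiffAt ℝ N (fun z => A z i j) x) : ContDiffAt ℝ N (fun z => (A z).det) x := by
  simp only [Matrix.det_apply']
  exact ContDiffAt.sum fun σ _ => contDiffAt_const.mul (contDiffAt_prod fun i _ => hA _ _)

/-- Cramer's rule: an entry of the inverse is a cofactor over the determinant, and the cofactor is
the determinant of a matrix with one row made constant. -/
theorem contDiffAt_inv_apply {A : E → Matrix ι ι ℝ}
    (hA : ∀ i j, ContDiffAt ℝ N (fun z => A z i j) x) (hx : (A x).det ≠ 0) (i j : ι) :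
    ContDiffAt ℝ N (fun z => (A z)⁻¹ i j) x := by
  simp only [Matrix.inv_def, Matrix.smul_apply, Ring.inverse_eq_inv', Matrix.adjugate_apply,
    smul_eq_mul]
  refine ((contDiffAt_det hA).inv hx).mul (contDiffAt_det fun a b => ?_)
  by_cases h : a = j
  · subst h; simp only [Matrix.updateRow_self]; exact contDiffAt_const
  · simp only [Matrix.updateRow_ne h]; exact hA a b

end MatrixSmoothness

/-! ### Charts of fibres from the inverse function theorem. -/

section Chart

variable {X W Y : Type*} [NormedAddCommGroup X] [NormedSpace ℝ X] [FiniteDimensional ℝ X]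
  [NormedAddCommGroup W] [NormedSpace ℝ W] [FiniteDimensional ℝ W]
  [NormedAddCommGroup Y] [NormedSpace ℝ Y] [FiniteDimensional ℝ Y]

/-- A fibre of a submersion is locally parametrized by a linear coordinate system `P` that is
complementary to the derivative. -/
theorem exists_chart {F : X → Y} (hF : ContDiff ℝ ∞ F) (P : X →L[ℝ] W) (x₀ : X)
    (hinj : ∀ w, P w = 0 → fderiv ℝ F x₀ w = 0 → w = 0)
    (hdim : Module.finrank ℝ X = Module.finrank ℝ W + Module.finrank ℝ Y) :
    ∃ ψ : W → X, ContDiffAt ℝ ∞ ψ 0 ∧ ψ 0 = x₀ ∧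
      ∀ᶠ ρ in 𝓝[>] (0 : ℝ), (∀ v ∈ Metric.ball (0 : W) ρ, F (ψ v) = F x₀ ∧ P (ψ v - x₀) = v) ∧
        ∃ N, IsOpen N ∧ x₀ ∈ N ∧ ψ '' Metric.ball 0 ρ = F ⁻¹' {F x₀} ∩ N := by
  have : CompleteSpace X := FiniteDimensional.complete ℝ X
  -- The derivative of `G` at `x₀` is injective by complementarity and bijective by the dimension
  -- count. The chart is the local inverse of `G` on the slice where the second coordinate is `F
  -- x₀`.
  set G : X → W × Y := fun x => (P (x - x₀), F x) with hG
  set L : X →L[ℝ] W × Y := P.prod (fderiv ℝ F x₀) with hL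
  have hLinj : Function.Injective (L : X →ₗ[ℝ] W × Y) := by
    rw [← LinearMap.ker_eq_bot, LinearMap.ker_eq_bot']
    intro w hw
    have h1 : (P w, fderiv ℝ F x₀ w) = 0 := hw
    exact hinj w (congrArg Prod.fst h1) (congrArg Prod.snd h1)
  set L' : X ≃L[ℝ] W × Y := (LinearEquiv.ofInjectiveOfFinrankEq (L : X →ₗ[ℝ] W × Y) hLinj
    (by rw [Module.finrank_prod, hdim])).toContinuousLinearEquiv with hL'
  have hLL' : (L' : X →L[ℝ] W × Y) = L := by ext1 w; rfl
  have hGs : ContDiff ℝ ∞ G := (P.contDiff.comp (contDiff_id.sub contDiff_const)).prodMk hF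
  have hGd : HasFDerivAt G (L' : X →L[ℝ] W × Y) x₀ := by
    rw [hLL']
    exact (P.hasFDerivAt.comp x₀ ((hasFDerivAt_id x₀).sub_const x₀)).prodMk
      ((hF.differentiable (by simp)).differentiableAt.hasFDerivAt)
  have hn : (∞ : WithTop ℕ∞) ≠ 0 := by simp
  set e := hGs.contDiffAt.toOpenPartialHomeomorph G hGd hn with he
  have hecoe : ∀ x, e x = G x := fun x => rfl
  have hG0 : G x₀ = (0, F x₀) := by simp [hG]
  have hsrc : x₀ ∈ e.source := hGs.contDiffAt.mem_toOpenPartialHomeomorph_source hGd hn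
  have htgt : ((0 : W), F x₀) ∈ e.target := hG0 ▸ e.map_source hsrc
  have hsymm : ContDiffAt ℝ ∞ e.symm ((0 : W), F x₀) := by
    have := hGs.contDiffAt.to_localInverse hGd hn
    rw [hG0] at this
    exact this
  set ψ : W → X := fun v => e.symm (v, F x₀) with hψ
  refine ⟨ψ, ?_, ?_, ?_⟩
  · exact hsymm.comp (0 : W) (contDiffAt_id.prodMk contDiffAt_const)
  · change e.symm (0, F x₀) = x₀
    rw [← hG0, ← hecoe, e.left_inv hsrc]
  · have hΩ : ∀ᶠ v in 𝓝 (0 : W), (v, F x₀) ∈ e.target :=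
      (by fun_prop : Continuous fun v : W => (v, F x₀)).continuousAt.eventually_mem
        (e.open_target.mem_nhds htgt)
    obtain ⟨ρ₀, hρ₀, hball⟩ := Metric.eventually_nhds_iff_ball.1 hΩ
    filter_upwards [Ioo_mem_nhdsGT hρ₀] with ρ hρ
    have hin : ∀ v ∈ Metric.ball (0 : W) ρ, (v, F x₀) ∈ e.target := fun v hv =>
      hball v (Metric.ball_subset_ball hρ.2.le hv)
    have hGψ : ∀ v ∈ Metric.ball (0 : W) ρ, G (ψ v) = (v, F x₀) := fun v hv => by
      rw [← hecoe]; exact e.right_inv (hin v hv)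
    have hprop : ∀ v ∈ Metric.ball (0 : W) ρ, F (ψ v) = F x₀ ∧ P (ψ v - x₀) = v := fun v hv =>
      ⟨congrArg Prod.snd (hGψ v hv), congrArg Prod.fst (hGψ v hv)⟩
    -- Intersecting with the preimage of the ball cuts the fibre to exactly the points with
    -- admissible coordinates.
    refine ⟨hprop, e.source ∩ (fun x => P (x - x₀)) ⁻¹' Metric.ball 0 ρ,
      e.open_source.inter (Metric.isOpen_ball.preimage (by fun_prop)), ⟨hsrc, by simpa using hρ.1⟩,
      ?_⟩
    ext x
    constructor
    · rintro ⟨v, hv, rfl⟩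
      refine ⟨(hprop v hv).1, e.map_target (hin v hv), ?_⟩
      rw [Set.mem_preimage, (hprop v hv).2]
      exact hv
    · rintro ⟨hx1, hx2, hx3⟩
      refine ⟨P (x - x₀), hx3, ?_⟩
      have hxF : F x = F x₀ := hx1
      have : (P (x - x₀), F x₀) = e x := by rw [hecoe, ← hxF]
      change e.symm (P (x - x₀), F x₀) = x
      rw [this, e.left_inv hx2]

end Chart

/-! ### The second-order necessary condition. -/

section SecondOrder

/-- At a local minimum the second derivative is positive semidefinite. -/
theorem _root_.IsLocalMin.fderiv_fderiv_nonneg {E : Type*} [NormedAddCommGroup E] [NormedSpace ℝ E]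
    {f : E → ℝ} {x : E} (hmin : IsLocalMin f x) (hf : ContDiffAt ℝ 2 f x) (v : E) :
    0 ≤ fderiv ℝ (fderiv ℝ f) x v v := by
  -- A negative second derivative along a line would make the point a local maximum there too, so
  -- `f` would be locally constant on the line, with second derivative zero.
  by_contra! hneg
  set γ : ℝ → E := fun t => x + t • v with hγ
  have hγd : ∀ t, HasDerivAt γ v t := fun t =>
    (((hasDerivAt_id t).smul_const v).const_add x).congr_deriv (one_smul _ _)
  have hγ0 : γ 0 = x := by simp [hγ]
  have hγt : Tendsto γ (𝓝 0) (𝓝 x) := by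
    have := (hγd 0).continuousAt.tendsto
    rwa [hγ0] at this
  have hd : ∀ᶠ z in 𝓝 x, DifferentiableAt ℝ f z :=
    (hf.eventually (by simp)).mono fun z hz => hz.differentiableAt (by simp)
  have h1 : deriv (f ∘ γ) =ᶠ[𝓝 0] fun t => fderiv ℝ f (γ t) v :=
    (hγt.eventually hd).mono fun t ht => (ht.hasFDerivAt.comp_hasDerivAt t (hγd t)).deriv
  have h2 : HasDerivAt (fun t => fderiv ℝ f (γ t) v) (fderiv ℝ (fderiv ℝ f) x v v) 0 := by
    have h3 : HasFDerivAt (fderiv ℝ f) (fderiv ℝ (fderiv ℝ f) x) (γ 0) := by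
      rw [hγ0]
      exact ((hf.fderiv_right (m := 1) (by norm_num)).differentiableAt (by simp)).hasFDerivAt
    have := (h3.comp_hasDerivAt 0 (hγd 0)).clm_apply (hasDerivAt_const (0 : ℝ) v)
    simpa using this
  have h4 : deriv (deriv (f ∘ γ)) 0 = fderiv ℝ (fderiv ℝ f) x v v := by
    rw [h1.deriv_eq, h2.deriv]
  have hmin' : IsLocalMin (f ∘ γ) 0 := by
    have := hγt.eventually hmin
    simpa [IsLocalMin, IsMinFilter, hγ0] using this
  have hmax : IsLocalMax (f ∘ γ) 0 := isLocalMax_of_deriv_deriv_neg (by rwa [h4])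
    hmin'.deriv_eq_zero (by
      have h5 : DifferentiableAt ℝ f (γ 0) := by rw [hγ0]; exact hd.self_of_nhds
      exact (h5.hasFDerivAt.comp_hasDerivAt 0 (hγd 0)).continuousAt)
  have hconst : f ∘ γ =ᶠ[𝓝 0] fun _ => (f ∘ γ) 0 := by
    filter_upwards [hmin', hmax] with t ht1 ht2 using le_antisymm ht2 ht1
  have h5 : deriv (f ∘ γ) =ᶠ[𝓝 0] fun _ => 0 := by
    filter_upwards [hconst.deriv] with t ht
    rw [ht]; simp
  rw [← h4, h5.deriv_eq] at hneg
  simp at hneg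

end SecondOrder

/-! ### Coordinate formulas for the projection and the Hessians. -/

section Projection

theorem two_le_infty : (2 : WithTop ℕ∞) ≤ ∞ := WithTop.coe_le_coe.2 le_top

/-- The action of a derivative on vectors in terms of partial derivatives. -/
theorem fderiv_apply_eq_sum {G : Type*} [NormedAddCommGroup G] [NormedSpace ℝ G]
    (L : EuclideanSpace ℝ (Fin d) →L[ℝ] G) (w : EuclideanSpace ℝ (Fin d)) :
    L w = ∑ i, w i • L (EuclideanSpace.single i 1) := by
  conv_lhs => rw [← (EuclideanSpace.basisFun (Fin d) ℝ).sum_repr w]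
  simp

theorem fderiv_apply_eq_dotProduct_grad (R : EuclideanSpace ℝ (Fin d) → ℝ)
    (x w : EuclideanSpace ℝ (Fin d)) : fderiv ℝ R x w = grad R x ⬝ᵥ w.ofLp := by
  rw [fderiv_apply_eq_sum, dotProduct]
  exact Finset.sum_congr rfl fun i _ => by rw [smul_eq_mul, mul_comm]; rfl

theorem fderiv_apply_eq_jacobian_mulVec (F : EuclideanSpace ℝ (Fin d) → EuclideanSpace ℝ (Fin k))
    (x w : EuclideanSpace ℝ (Fin d)) : (fderiv ℝ F x w).ofLp = jacobian F x *ᵥ w.ofLp := by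
  ext i
  rw [fderiv_apply_eq_sum, Matrix.mulVec, dotProduct]
  simp [jacobian, mul_comm]

variable {F : EuclideanSpace ℝ (Fin d) → EuclideanSpace ℝ (Fin k)}

/-- The subtracted term ends in `DF w = 0`, so no rank condition at `x` is needed. This makes the
identity available at all chart points near the centre. -/
theorem tangentProj_mulVec_of_fderiv_eq_zero {x w : EuclideanSpace ℝ (Fin d)}
    (hw : fderiv ℝ F x w = 0) : tangentProj F x *ᵥ w.ofLp = w.ofLp := by
  have h : jacobian F x *ᵥ w.ofLp = 0 := by
    rw [← fderiv_apply_eq_jacobian_mulVec, hw]; rfl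
  rw [tangentProj, Matrix.sub_mulVec, Matrix.one_mulVec, ← Matrix.mulVec_mulVec, h,
    Matrix.mulVec_zero, sub_zero]

theorem tangentProj_transpose (x : EuclideanSpace ℝ (Fin d)) :
    (tangentProj F x)ᵀ = tangentProj F x := by
  have hG : (gram F x)ᵀ = gram F x := by simp [gram, Matrix.transpose_mul]
  simp only [tangentProj, Matrix.transpose_sub, Matrix.transpose_one, Matrix.transpose_mul,
    Matrix.transpose_nonsing_inv, Matrix.transpose_transpose, hG, Matrix.mul_assoc]

theorem contDiff_jacobian_apply (hF : ContDiff ℝ ∞ F) (i : Fin k) (j : Fin d) :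
    ContDiff ℝ ∞ fun x => jacobian F x i j := by
  have h1 : ContDiff ℝ ∞ fun x => fderiv ℝ F x (EuclideanSpace.single j 1) :=
    (hF.fderiv_right (m := ∞) (by simp)).clm_apply contDiff_const
  exact (contDiff_euclidean.1 h1) i

theorem contDiff_grad_apply {R : EuclideanSpace ℝ (Fin d) → ℝ} (hR : ContDiff ℝ ∞ R) (j : Fin d) :
    ContDiff ℝ ∞ fun x => grad R x j :=
  (hR.fderiv_right (m := ∞) (by simp)).clm_apply contDiff_const

theorem contDiffAt_tangentProj_apply (hF : ContDiff ℝ ∞ F) {x : EuclideanSpace ℝ (Fin d)}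
    (hx : (gram F x).det ≠ 0) (i j : Fin d) :
    ContDiffAt ℝ ∞ (fun z => tangentProj F z i j) x := by
  have hJ := fun a b => (contDiff_jacobian_apply hF a b).contDiffAt (x := x)
  have hG : ∀ a b, ContDiffAt ℝ ∞ (fun z => gram F z a b) x := fun a b => by
    simp only [gram, Matrix.mul_apply, Matrix.transpose_apply]
    exact ContDiffAt.sum fun c _ => (hJ _ _).mul (hJ _ _)
  have hI := contDiffAt_inv_apply hG hx
  simp only [tangentProj, Matrix.sub_apply, Matrix.mul_apply, Matrix.transpose_apply]
  exact contDiffAt_const.sub (ContDiffAt.sum fun b _ =>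
    (ContDiffAt.sum fun a _ => (hJ _ _).mul (hI _ _)).mul (hJ _ _))

/-- Over the reals `A Aᵀ` has the rank of `A`. -/
theorem gram_det_ne_zero_of_rank {x : EuclideanSpace ℝ (Fin d)} (hx : (jacobian F x).rank = k) :
    (gram F x).det ≠ 0 := by
  have h : (gram F x).rank = k := by rw [gram, Matrix.rank_self_mul_transpose, hx]
  have htop : (gram F x).mulVecLin.range = ⊤ :=
    Submodule.eq_top_of_finrank_eq (by rw [Module.finrank_fin_fun]; exact h)
  have hunit := Matrix.mulVec_surjective_iff_isUnit.1 (LinearMap.range_eq_top.1 htop)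
  exact ((Matrix.isUnit_iff_isUnit_det _).1 hunit).ne_zero

theorem dirDerivProj_transpose (x : EuclideanSpace ℝ (Fin d)) (v : Fin d → ℝ) :
    (dirDerivProj F x v)ᵀ = dirDerivProj F x v := by
  ext i j
  simp only [dirDerivProj, Matrix.transpose_apply, Matrix.of_apply]
  congr 2
  ext z
  exact congrFun (congrFun (tangentProj_transpose (F := F) z) i) j

theorem hessian_transpose {R : EuclideanSpace ℝ (Fin d) → ℝ} (hR : ContDiff ℝ ∞ R)
    (x : EuclideanSpace ℝ (Fin d)) : (hessian R x)ᵀ = hessian R x := by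
  have hd : DifferentiableAt ℝ (fderiv ℝ R) x :=
    ((hR.fderiv_right (m := ∞) (by simp)).differentiable (by simp)).differentiableAt
  have happ : ∀ i j, hessian R x i j =
      fderiv ℝ (fderiv ℝ R) x (EuclideanSpace.single i 1) (EuclideanSpace.single j 1) := by
    intro i j
    simp only [hessian, Matrix.of_apply, grad]
    rw [fderiv_clm_apply hd (differentiableAt_const _)]
    simp
  have hsymm : IsSymmSndFDerivAt ℝ R x :=
    (hR.contDiffAt.of_le (two_le_infty)).isSymmSndFDerivAt
      (by simp)
  ext i j
  rw [Matrix.transpose_apply, happ, happ, hsymm.eq]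

/-- The manifold Hessian as a linear map. -/
theorem manifoldHessian_mulVec (R : EuclideanSpace ℝ (Fin d) → ℝ) (x : EuclideanSpace ℝ (Fin d))
    (U : Matrix (Fin d) (Fin p) ℝ) (u : Fin p → ℝ) :
    manifoldHessian F R x U *ᵥ u =
      Uᵀ *ᵥ (hessian R x *ᵥ (U *ᵥ u) + dirDerivProj F x (U *ᵥ u) *ᵥ grad R x) := by
  have hlin : IsLinearMap ℝ fun u : Fin p → ℝ =>
      Uᵀ *ᵥ (hessian R x *ᵥ (U *ᵥ u) + dirDerivProj F x (U *ᵥ u) *ᵥ grad R x) := by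
    have hadd : ∀ a b, dirDerivProj F x (a + b) = dirDerivProj F x a + dirDerivProj F x b :=
      fun a b => by ext i j; simp [dirDerivProj]
    have hsmul : ∀ (c : ℝ) a, dirDerivProj F x (c • a) = c • dirDerivProj F x a :=
      fun c a => by ext i j; simp [dirDerivProj]
    constructor
    · intro a b
      simp only [Matrix.mulVec_add, hadd, Matrix.add_mulVec]
      abel
    · intro c a
      simp only [Matrix.mulVec_add, Matrix.mulVec_smul, hsmul, Matrix.smul_mulVec, smul_add]
  have hmat : manifoldHessian F R x U = LinearMap.toMatrix' hlin.mk' := by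
    ext a b
    rw [LinearMap.toMatrix'_apply]
    rfl
  rw [hmat, ← Matrix.toLin'_apply, Matrix.toLin'_toMatrix']
  rfl

end Projection

/-! ### The manifold Hessian as a second derivative in a chart. -/

section ChartHessian

variable {F : EuclideanSpace ℝ (Fin d) → EuclideanSpace ℝ (Fin k)}

/-- In a chart of the fibre that is linear in the tangential coordinates, the second derivative of
a function is given by the manifold Hessian. -/
theorem fderiv_fderiv_comp_chart (hF : ContDiff ℝ ∞ F) {η : EuclideanSpace ℝ (Fin d) → ℝ}
    (hη : ContDiff ℝ ∞ η) {θ : EuclideanSpace ℝ (Fin d)} (hrank : (jacobian F θ).rank = k)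
    {U : Matrix (Fin d) (Fin p) ℝ} (hU : IsTangentFrame F θ U) {S : Matrix (Fin p) (Fin p) ℝ}
    {ψ : EuclideanSpace ℝ (Fin p) → EuclideanSpace ℝ (Fin d)} (hψ : ContDiffAt ℝ ∞ ψ 0)
    (hψ0 : ψ 0 = θ) (hFψ : ∀ᶠ x in 𝓝 0, F (ψ x) = F θ)
    (hUψ : ∀ᶠ x in 𝓝 0, Uᵀ *ᵥ (ψ x - θ).ofLp = S *ᵥ x.ofLp) :
    (∀ v, (fderiv ℝ ψ 0 v).ofLp = U *ᵥ (S *ᵥ v.ofLp)) ∧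
    ∀ v w, fderiv ℝ (fderiv ℝ (η ∘ ψ)) 0 v w =
      (S *ᵥ w.ofLp) ⬝ᵥ (manifoldHessian F η θ U *ᵥ (S *ᵥ v.ofLp)) := by
  have hψ1 : ∀ᶠ x in 𝓝 (0 : EuclideanSpace ℝ (Fin p)), DifferentiableAt ℝ ψ x :=
    ((hψ.of_le (two_le_infty)).eventually (by simp)).mono
      fun x hx => hx.differentiableAt (by simp)
  have hFd : ∀ z, DifferentiableAt ℝ F z := fun z => (hF.differentiable (by simp)).differentiableAt
  have hηd : ∀ z, DifferentiableAt ℝ η z := fun z => (hη.differentiable (by simp)).differentiableAt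
  -- derivatives of the two chart equations
  have hFker : ∀ᶠ x in 𝓝 0, ∀ w, fderiv ℝ F (ψ x) (fderiv ℝ ψ x w) = 0 := by
    filter_upwards [hFψ.eventually_nhds, hψ1] with x hx hx1 w
    have h1 := ((hFd (ψ x)).hasFDerivAt.comp x hx1.hasFDerivAt).fderiv
    have h2 : F ∘ ψ =ᶠ[𝓝 x] fun _ => F θ := hx
    rw [h2.fderiv_eq, fderiv_fun_const] at h1
    exact (DFunLike.congr_fun h1 w).symm
  set UT : EuclideanSpace ℝ (Fin d) →L[ℝ] EuclideanSpace ℝ (Fin p) :=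
    (Matrix.toLpLin 2 2 Uᵀ).toContinuousLinearMap with hUT
  set SL : EuclideanSpace ℝ (Fin p) →L[ℝ] EuclideanSpace ℝ (Fin p) :=
    (Matrix.toLpLin 2 2 S).toContinuousLinearMap with hSL
  have hUTψ : ∀ᶠ x in 𝓝 0, ∀ w, UT (fderiv ℝ ψ x w) = SL w := by
    have h0 : ∀ᶠ x in 𝓝 0, UT (ψ x - θ) = SL x := hUψ.mono fun x hx => by
      ext i; exact congrFun hx i
    filter_upwards [h0.eventually_nhds, hψ1] with x hx hx1 w
    have h1 := (UT.hasFDerivAt.comp x (hx1.hasFDerivAt.sub_const θ)).fderiv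
    have h2 : (UT ∘ fun x => ψ x - θ) =ᶠ[𝓝 x] SL := hx
    rw [h2.fderiv_eq, SL.fderiv] at h1
    exact (DFunLike.congr_fun h1 w).symm
  have hproj : ∀ᶠ x in 𝓝 0, ∀ w, tangentProj F (ψ x) *ᵥ (fderiv ℝ ψ x w).ofLp =
      (fderiv ℝ ψ x w).ofLp := hFker.mono fun x hx w => tangentProj_mulVec_of_fderiv_eq_zero (hx w)
  have hUUw : ∀ z : EuclideanSpace ℝ (Fin d), tangentProj F θ *ᵥ z.ofLp = U *ᵥ (UT z).ofLp := by
    intro z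
    rw [← hU.2, ← Matrix.mulVec_mulVec]
    rfl
  have hD0 : ∀ v, (fderiv ℝ ψ 0 v).ofLp = U *ᵥ (S *ᵥ v.ofLp) := by
    intro v
    have h1 := hproj.self_of_nhds v
    rw [hψ0, hUUw, hUTψ.self_of_nhds v] at h1
    exact h1.symm
  refine ⟨hD0, fun v w => ?_⟩
  have hDψ : DifferentiableAt ℝ (fderiv ℝ ψ) 0 :=
    (hψ.fderiv_right (m := ∞) (by simp)).differentiableAt (by simp)
  have hψd : HasFDerivAt ψ (fderiv ℝ ψ 0) 0 := hψ1.self_of_nhds.hasFDerivAt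
  set a := fderiv ℝ ψ 0 v with ha
  set b := fderiv ℝ ψ 0 w with hb
  set c := fderiv ℝ (fderiv ℝ ψ) 0 v w with hc
  have hDψw : HasFDerivAt (fun x => fderiv ℝ ψ x w)
      ((ContinuousLinearMap.apply ℝ (EuclideanSpace ℝ (Fin d)) w) ∘L
        fderiv ℝ (fderiv ℝ ψ) 0) 0 :=
    (ContinuousLinearMap.apply ℝ (EuclideanSpace ℝ (Fin d)) w).hasFDerivAt.comp 0 hDψ.hasFDerivAt
  -- The tangential component of `fderiv ℝ ψ x w` is the constant `S w`, so the second derivative of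
  -- the chart has no tangential component.
  have hUc : UT c = 0 := by
    have h1 := UT.hasFDerivAt.comp 0 hDψw
    have h2 : (UT ∘ fun x => fderiv ℝ ψ x w) =ᶠ[𝓝 0] fun _ => SL w := hUTψ.mono fun x hx => hx w
    have h3 := h1.fderiv
    rw [h2.fderiv_eq, fderiv_fun_const] at h3
    exact (DFunLike.congr_fun h3 v).symm
  have hprojc : tangentProj F θ *ᵥ c.ofLp = 0 := by
    rw [hUUw, hUc]; exact Matrix.mulVec_zero U
  have hprojb : tangentProj F θ *ᵥ b.ofLp = b.ofLp := by
    have := hproj.self_of_nhds w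
    rwa [hψ0] at this
  -- Inserting the redundant projection before differentiating again is the key: the product rule
  -- then produces `∇Π`, and the term with `c` appears as `Π c = 0`.
  have hfirst : (fun x => fderiv ℝ (η ∘ ψ) x w) =ᶠ[𝓝 0] fun x =>
      ∑ j, grad η (ψ x) j * ∑ l, tangentProj F (ψ x) j l * (fderiv ℝ ψ x w) l := by
    filter_upwards [hψ1, hproj] with x hx1 hx2
    rw [((hηd (ψ x)).hasFDerivAt.comp x hx1.hasFDerivAt).fderiv]
    rw [ContinuousLinearMap.comp_apply, fderiv_apply_eq_dotProduct_grad]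
    conv_lhs => rw [← hx2 w]
    rfl
  have hgradd : ∀ j, HasFDerivAt (fun x => grad η (ψ x) j)
      (fderiv ℝ (fun z => grad η z j) θ ∘L fderiv ℝ ψ 0) 0 := fun j => by
    have h : HasFDerivAt (fun z => grad η z j) (fderiv ℝ (fun z => grad η z j) θ) (ψ 0) := by
      rw [hψ0]
      exact ((contDiff_grad_apply hη j).differentiable (by simp)).differentiableAt.hasFDerivAt
    exact h.comp 0 hψd
  have hprojd : ∀ j l, HasFDerivAt (fun x => tangentProj F (ψ x) j l)
      (fderiv ℝ (fun z => tangentProj F z j l) θ ∘L fderiv ℝ ψ 0) 0 := fun j l => by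
    have h : HasFDerivAt (fun z => tangentProj F z j l)
        (fderiv ℝ (fun z => tangentProj F z j l) θ) (ψ 0) := by
      rw [hψ0]
      exact ((contDiffAt_tangentProj_apply hF (gram_det_ne_zero_of_rank hrank) j l).differentiableAt
        (by simp)).hasFDerivAt
    exact h.comp 0 hψd
  have hψl : ∀ l, HasFDerivAt (fun x => (fderiv ℝ ψ x w) l)
      ((EuclideanSpace.proj l : EuclideanSpace ℝ (Fin d) →L[ℝ] ℝ) ∘L
        ((ContinuousLinearMap.apply ℝ (EuclideanSpace ℝ (Fin d)) w) ∘L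
          fderiv ℝ (fderiv ℝ ψ) 0)) 0 := fun l =>
    (EuclideanSpace.proj l : EuclideanSpace ℝ (Fin d) →L[ℝ] ℝ).hasFDerivAt.comp 0 hDψw
  have hsum := HasFDerivAt.fun_sum (u := Finset.univ) fun j _ =>
    (hgradd j).fun_mul (HasFDerivAt.fun_sum (u := Finset.univ) fun l _ => (hprojd j l).fun_mul (hψl l))
  have hfd : DifferentiableAt ℝ (fderiv ℝ (η ∘ ψ)) 0 := by
    have : ContDiffAt ℝ ∞ (η ∘ ψ) 0 := hη.contDiffAt.comp 0 hψ
    exact (this.fderiv_right (m := ∞) (by simp)).differentiableAt (by simp)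
  have hlhs : fderiv ℝ (fderiv ℝ (η ∘ ψ)) 0 v w =
      fderiv ℝ (fun x => fderiv ℝ (η ∘ ψ) x w) 0 v := by
    rw [fderiv_clm_apply hfd (differentiableAt_const _)]
    simp
  have hhess : ∀ j, fderiv ℝ (fun z => grad η z j) θ a = (hessian η θ *ᵥ a.ofLp) j := fun j => by
    rw [← hessian_transpose hη, Matrix.mulVec, dotProduct, fderiv_apply_eq_sum]
    exact Finset.sum_congr rfl fun i _ => by rw [smul_eq_mul, mul_comm]; rfl
  have hdir : ∀ j l, fderiv ℝ (fun z => tangentProj F z j l) θ a =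
      dirDerivProj F θ a.ofLp j l := fun j l => rfl
  have hprojapp : ∀ (z : EuclideanSpace ℝ (Fin d)) l,
      (EuclideanSpace.proj l : EuclideanSpace ℝ (Fin d) →L[ℝ] ℝ) z = z l := fun _ _ => rfl
  have hval : fderiv ℝ (fderiv ℝ (η ∘ ψ)) 0 v w =
      (hessian η θ *ᵥ a.ofLp) ⬝ᵥ (tangentProj F θ *ᵥ b.ofLp) +
        (grad η θ ⬝ᵥ (dirDerivProj F θ a.ofLp *ᵥ b.ofLp) +
          grad η θ ⬝ᵥ (tangentProj F θ *ᵥ c.ofLp)) := by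
    rw [hlhs, hfirst.fderiv_eq, hsum.fderiv]
    simp only [sum_apply, add_apply,
      smul_apply, ContinuousLinearMap.comp_apply, smul_eq_mul, hψ0, ← ha,
      hhess, hdir, dotProduct, Matrix.mulVec]
    rw [← Finset.sum_add_distrib, ← Finset.sum_add_distrib]
    refine Finset.sum_congr rfl fun j _ => ?_
    simp only [Finset.sum_add_distrib, hprojapp, ContinuousLinearMap.apply_apply,
      ← hb, ← hc]
    have e1 : ∑ l, b l * dirDerivProj F θ a.ofLp j l = ∑ l, dirDerivProj F θ a.ofLp j l * b l :=
      Finset.sum_congr rfl fun l _ => mul_comm _ _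
    rw [e1]
    ring
  rw [hval, hprojb, hprojc, dotProduct_zero, add_zero, manifoldHessian_mulVec, ← hD0 v, ← ha,
    Matrix.dotProduct_mulVec (S *ᵥ w.ofLp), Matrix.vecMul_transpose, ← hD0 w, ← hb,
    dotProduct_add, dotProduct_comm b.ofLp, dotProduct_comm b.ofLp,
    Matrix.dotProduct_mulVec (grad η θ), ← Matrix.mulVec_transpose, dirDerivProj_transpose]

end ChartHessian

/-! ### Normalizing the Hessian and computing the volume factor. -/

section Normalization

open scoped MatrixOrder in
/-- A nonsingular positive semidefinite matrix is congruent to the identity. -/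
theorem exists_transpose_mul_mul_eq_one {H : Matrix (Fin p) (Fin p) ℝ} (hH : H.PosSemidef)
    (hdet : H.det ≠ 0) : ∃ S : Matrix (Fin p) (Fin p) ℝ, S.det ≠ 0 ∧ Sᵀ * H * S = 1 := by
  -- Writing `H = aᵀ a`, the congruence is given by `a⁻¹`.
  obtain ⟨a, rfl⟩ := CStarAlgebra.nonneg_iff_eq_star_mul_self.mp hH.nonneg
  have ha : IsUnit a.det := by
    rw [Matrix.det_mul] at hdet
    exact (right_ne_zero_of_mul hdet).isUnit
  refine ⟨a⁻¹, (Matrix.isUnit_nonsing_inv_det a ha).ne_zero, ?_⟩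
  have h1 : (a⁻¹)ᵀ * star a = 1 := by
    rw [Matrix.star_eq_conjTranspose, Matrix.conjTranspose_eq_transpose_of_trivial,
      ← Matrix.transpose_mul, Matrix.mul_nonsing_inv _ ha, Matrix.transpose_one]
  rw [← Matrix.mul_assoc, h1, Matrix.one_mul, Matrix.mul_nonsing_inv _ ha]

theorem normDet_eq_sqrt_det (A : EuclideanSpace ℝ (Fin p) →L[ℝ] EuclideanSpace ℝ (Fin d)) :
    LinearMap.normDet (A : EuclideanSpace ℝ (Fin p) →ₗ[ℝ] EuclideanSpace ℝ (Fin d)) =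
      √(Matrix.gram ℝ fun i : Fin p => A (EuclideanSpace.single i 1)).det := by
  have h := LinearMap.normDet_sq_eq_det_gram
    (A : EuclideanSpace ℝ (Fin p) →ₗ[ℝ] EuclideanSpace ℝ (Fin d)) (EuclideanSpace.basisFun (Fin p) ℝ)
  simp only [EuclideanSpace.basisFun_apply] at h
  change _ = (Matrix.gram ℝ fun i : Fin p => A (EuclideanSpace.single i 1)).det at h
  rw [← h]
  exact (Real.sqrt_sq (LinearMap.normDet_nonneg _)).symm

/-- The volume factor of a linear map with matrix `U * S`, where `U` has orthonormal columns. -/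
theorem normDet_eq_abs_det_of_orthonormal {U : Matrix (Fin d) (Fin p) ℝ} (hU : Uᵀ * U = 1)
    {S : Matrix (Fin p) (Fin p) ℝ}
    {A : EuclideanSpace ℝ (Fin p) →L[ℝ] EuclideanSpace ℝ (Fin d)}
    (hA : ∀ v, (A v).ofLp = U *ᵥ (S *ᵥ v.ofLp)) :
    LinearMap.normDet (A : EuclideanSpace ℝ (Fin p) →ₗ[ℝ] EuclideanSpace ℝ (Fin d)) = |S.det| := by
  have hg : (Matrix.gram ℝ fun i : Fin p => A (EuclideanSpace.single i 1)) = Sᵀ * S := by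
    have hcol : ∀ i l, (A (EuclideanSpace.single i 1)).ofLp l = (U * S) l i := fun i l => by
      rw [hA, Matrix.mulVec_mulVec]
      simp
    have hUS : Sᵀ * S = (U * S)ᵀ * (U * S) := by
      rw [Matrix.transpose_mul, Matrix.mul_assoc, ← Matrix.mul_assoc Uᵀ, hU, Matrix.one_mul]
    ext i j
    rw [hUS, Matrix.gram_apply, PiLp.inner_apply, Matrix.mul_apply]
    simp only [hcol, Matrix.transpose_apply]
    exact Finset.sum_congr rfl fun l _ => mul_comm _ _
  rw [normDet_eq_sqrt_det, hg, Matrix.det_mul, Matrix.det_transpose, Real.sqrt_mul_self_eq_abs]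

/-- The square root of the Gram determinant is smooth because injectivity keeps that determinant
away from zero. -/
theorem contDiffAt_normDet_fderiv
    {ψ : EuclideanSpace ℝ (Fin p) → EuclideanSpace ℝ (Fin d)} {x : EuclideanSpace ℝ (Fin p)}
    (hψ : ContDiffAt ℝ ∞ ψ x) (hinj : Function.Injective (fderiv ℝ ψ x)) :
    ContDiffAt ℝ ∞ (fun z => LinearMap.normDet
      (fderiv ℝ ψ z : EuclideanSpace ℝ (Fin p) →ₗ[ℝ] EuclideanSpace ℝ (Fin d))) x := by
  have hne : LinearMap.normDet
      (fderiv ℝ ψ x : EuclideanSpace ℝ (Fin p) →ₗ[ℝ] EuclideanSpace ℝ (Fin d)) ≠ 0 :=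
    ((fderiv ℝ ψ x : EuclideanSpace ℝ (Fin p) →ₗ[ℝ]
      EuclideanSpace ℝ (Fin d)).normDet_ne_zero_tfae.out 4 0).1 hinj
  simp only [normDet_eq_sqrt_det] at hne ⊢
  refine ContDiffAt.sqrt (contDiffAt_det fun i j => ?_) fun h => hne (by rw [h, Real.sqrt_zero])
  have hD := hψ.fderiv_right (m := ∞) (by simp)
  simp only [Matrix.gram_apply]
  exact (hD.clm_apply contDiffAt_const).inner ℝ (hD.clm_apply contDiffAt_const)

end Normalization

/-! ### Tangential charts and Laplace's method near the minimum. -/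

section TangentChart

variable {F : EuclideanSpace ℝ (Fin d) → EuclideanSpace ℝ (Fin k)}

/-- A chart of the fibre through `θ` whose tangential coordinates are the frame coordinates
transformed by an invertible matrix. -/
theorem exists_tangent_chart (hF : ContDiff ℝ ∞ F) {θ : EuclideanSpace ℝ (Fin d)} (hd : d = p + k)
    {U : Matrix (Fin d) (Fin p) ℝ} (hU : IsTangentFrame F θ U) {S : Matrix (Fin p) (Fin p) ℝ}
    (hS : S.det ≠ 0) :
    ∃ (ψ : EuclideanSpace ℝ (Fin p) → EuclideanSpace ℝ (Fin d))
      (P : EuclideanSpace ℝ (Fin d) →L[ℝ] EuclideanSpace ℝ (Fin p)),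
      ContDiffAt ℝ ∞ ψ 0 ∧ ψ 0 = θ ∧ (∀ v w, P v = w → Uᵀ *ᵥ v.ofLp = S *ᵥ w.ofLp) ∧
      ∀ᶠ ρ in 𝓝[>] (0 : ℝ), (∀ v ∈ Metric.ball 0 ρ, F (ψ v) = F θ ∧ P (ψ v - θ) = v) ∧
        ∃ N, IsOpen N ∧ θ ∈ N ∧ ψ '' Metric.ball 0 ρ = F ⁻¹' {F θ} ∩ N := by
  have hSu : IsUnit S.det := hS.isUnit
  set P : EuclideanSpace ℝ (Fin d) →L[ℝ] EuclideanSpace ℝ (Fin p) :=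
    (Matrix.toLpLin 2 2 (S⁻¹ * Uᵀ)).toContinuousLinearMap with hP
  have hPU : ∀ v w, P v = w → Uᵀ *ᵥ v.ofLp = S *ᵥ w.ofLp := by
    rintro v _ rfl
    have h1 : (P v).ofLp = (S⁻¹ * Uᵀ) *ᵥ v.ofLp := rfl
    rw [h1, Matrix.mulVec_mulVec, ← Matrix.mul_assoc, Matrix.mul_nonsing_inv _ hSu, Matrix.one_mul]
  -- A vector in the kernel of `DF` satisfies `w = U Uᵀ w`, so vanishing frame coordinates force `w
  -- = 0`.
  obtain ⟨ψ, h1, h2, h3⟩ := exists_chart hF P θ (fun w hw1 hw2 => by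
    have e1 := tangentProj_mulVec_of_fderiv_eq_zero hw2
    have e2 := hPU w 0 hw1
    rw [← hU.2, ← Matrix.mulVec_mulVec, e2] at e1
    have e3 : S *ᵥ (0 : EuclideanSpace ℝ (Fin p)).ofLp = 0 := Matrix.mulVec_zero S
    rw [e3, Matrix.mulVec_zero] at e1
    ext i
    exact (congrFun e1 i).symm) (by simp [hd])
  exact ⟨ψ, P, h1, h2, hPU, h3⟩

theorem eventually_ball_of_eventually_nhds {E : Type*} [SeminormedAddCommGroup E] {P : E → Prop}
    (h : ∀ᶠ x in 𝓝 0, P x) : ∀ᶠ ρ in 𝓝[>] (0 : ℝ), ∀ x ∈ Metric.ball (0 : E) ρ, P x := by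
  obtain ⟨ρ₀, hρ₀, hb⟩ := Metric.eventually_nhds_iff_ball.1 h
  filter_upwards [Ioo_mem_nhdsGT hρ₀] with ρ hρ x hx
  exact hb x (Metric.ball_subset_ball hρ.2.le hx)

theorem eventually_nhds_of_eventually_ball {E : Type*} [SeminormedAddCommGroup E] {P : E → Prop}
    (h : ∀ᶠ ρ in 𝓝[>] (0 : ℝ), ∀ x ∈ Metric.ball (0 : E) ρ, P x) : ∀ᶠ x in 𝓝 (0 : E), P x := by
  obtain ⟨ρ, hρ, hρ0⟩ := (h.and self_mem_nhdsWithin).exists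
  exact eventually_of_mem (Metric.ball_mem_nhds 0 hρ0) hρ

/-- At a minimum on the fibre the manifold Hessian is positive semidefinite. -/
theorem manifoldHessian_posSemidef (hF : ContDiff ℝ ∞ F) {η : EuclideanSpace ℝ (Fin d) → ℝ}
    (hη : ContDiff ℝ ∞ η) {θ : EuclideanSpace ℝ (Fin d)} (hd : d = p + k)
    (hrank : (jacobian F θ).rank = k) {U : Matrix (Fin d) (Fin p) ℝ} (hU : IsTangentFrame F θ U)
    (hmin : ∀ z, F z = F θ → η θ ≤ η z) : (manifoldHessian F η θ U).PosSemidef := by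
  -- With `S = 1` the matrix is literally the second derivative of `η ∘ ψ`, which supplies symmetry
  -- and nonnegativity.
  obtain ⟨ψ, P, hψ, hψ0, hPU, hρ⟩ := exists_tangent_chart hF hd hU (S := 1) (by simp)
  have hev := eventually_nhds_of_eventually_ball (hρ.mono fun ρ h => h.1)
  obtain ⟨-, hD2⟩ := fderiv_fderiv_comp_chart hF hη hrank hU hψ hψ0 (hev.mono fun x hx => hx.1)
    (hev.mono fun x hx => hPU _ _ hx.2)
  have hf : ContDiffAt ℝ ∞ (η ∘ ψ) 0 := hη.contDiffAt.comp 0 hψ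
  have hf2 := hf.of_le two_le_infty
  have hlm : IsLocalMin (η ∘ ψ) 0 := hev.mono fun x hx => by
    simpa [hψ0] using hmin _ hx.1
  simp only [Matrix.one_mulVec] at hD2
  have hsymm : IsSymmSndFDerivAt ℝ (η ∘ ψ) 0 := hf2.isSymmSndFDerivAt (by simp)
  refine Matrix.PosSemidef.of_dotProduct_mulVec_nonneg ?_ fun v => ?_
  · ext i j
    have h1 := hD2 (EuclideanSpace.single i 1) (EuclideanSpace.single j 1)
    have h2 := hD2 (EuclideanSpace.single j 1) (EuclideanSpace.single i 1)
    rw [hsymm.eq, h2] at h1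
    simpa using h1.symm
  · have := hlm.fderiv_fderiv_nonneg hf2 (WithLp.toLp 2 v)
    rw [hD2] at this
    simpa using this

/-- Laplace's method on a neighbourhood of the minimum in the fibre. -/
theorem laplace_fibre_nhds (hF : ContDiff ℝ ∞ F) {η Q : EuclideanSpace ℝ (Fin d) → ℝ}
    (hη : ContDiff ℝ ∞ η) (hQ : ContDiff ℝ ∞ Q) {θ : EuclideanSpace ℝ (Fin d)} (hd : d = p + k)
    (hrank : (jacobian F θ).rank = k) {U : Matrix (Fin d) (Fin p) ℝ} (hU : IsTangentFrame F θ U)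
    (hmin : ∀ z, F z = F θ → η θ ≤ η z) (hns : (manifoldHessian F η θ U).det ≠ 0) :
    ∃ N, IsOpen N ∧ θ ∈ N ∧ ∃ K : ℝ, ∀ τ > 0,
      IntegrableOn (fun z => Real.exp (-(1 / τ) * η z) * Q z) (F ⁻¹' {F θ} ∩ N)
        (Measure.euclideanHausdorffMeasure p) ∧
      |(∫ z in F ⁻¹' {F θ} ∩ N, Real.exp (-(1 / τ) * η z) * Q z
          ∂(Measure.euclideanHausdorffMeasure p)) -
        (2 * Real.pi * τ) ^ (p / 2 : ℝ) * Real.exp (-(1 / τ) * η θ) * Q θ *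
          (manifoldHessian F η θ U).det ^ (-(1 / 2) : ℝ)| ≤
        K * τ * τ ^ (p / 2 : ℝ) * Real.exp (-(1 / τ) * η θ) := by
  set H := manifoldHessian F η θ U with hH
  have hpsd : H.PosSemidef := manifoldHessian_posSemidef hF hη hd hrank hU hmin
  obtain ⟨S, hS, hSHS⟩ := exists_transpose_mul_mul_eq_one hpsd hns
  obtain ⟨ψ, P, hψ, hψ0, hPU, hρ⟩ := exists_tangent_chart hF hd hU hS
  have hev := eventually_nhds_of_eventually_ball (hρ.mono fun ρ h => h.1)
  obtain ⟨hD1, hD2⟩ := fderiv_fderiv_comp_chart hF hη hrank hU hψ hψ0 (hev.mono fun x hx => hx.1)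
    (hev.mono fun x hx => hPU _ _ hx.2)
  have hf : ContDiffAt ℝ ∞ (η ∘ ψ) 0 := hη.contDiffAt.comp 0 hψ
  have hlm : IsLocalMin (η ∘ ψ) 0 := hev.mono fun x hx => by
    simpa [hψ0] using hmin _ hx.1
  have hf'' : fderiv ℝ (fderiv ℝ (η ∘ ψ)) 0 = innerSL ℝ := by
    ext v w
    rw [hD2, innerSL_apply_apply, Matrix.mulVec_mulVec, Matrix.dotProduct_mulVec,
      ← Matrix.mulVec_transpose, Matrix.mulVec_mulVec, Matrix.transpose_mul]
    have hHT : Hᵀ = H := by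
      rw [← Matrix.conjTranspose_eq_transpose_of_trivial]; exact hpsd.isHermitian
    rw [← hH, hHT, hSHS, Matrix.one_mulVec]
    simp [PiLp.inner_apply, dotProduct]
  have hψ2 : ∀ᶠ x in 𝓝 0, ContDiffAt ℝ 2 ψ x := (hψ.of_le two_le_infty).eventually (by simp)
  -- Differentiating `P (ψ x - θ) = x` shows that `P` is a left inverse of the derivative.
  have himm : ∀ᶠ x in 𝓝 0, Function.Injective (fderiv ℝ ψ x) := by
    filter_upwards [hev.eventually_nhds, hψ2] with x hx hx2
    have h1 := (P.hasFDerivAt.comp x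
      ((hx2.differentiableAt (by simp)).hasFDerivAt.sub_const θ)).fderiv
    have h2 : (P ∘ fun x => ψ x - θ) =ᶠ[𝓝 x] id := hx.mono fun z hz => hz.2
    rw [h2.fderiv_eq, fderiv_id] at h1
    refine Function.LeftInverse.injective (g := P) fun w => ?_
    exact (DFunLike.congr_fun h1 w).symm
  set g : EuclideanSpace ℝ (Fin p) → ℝ := fun x => LinearMap.normDet
      (fderiv ℝ ψ x : EuclideanSpace ℝ (Fin p) →ₗ[ℝ] EuclideanSpace ℝ (Fin d)) * Q (ψ x) with hg
  have hgc : ContDiffAt ℝ ∞ g 0 :=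
    (contDiffAt_normDet_fderiv hψ himm.self_of_nhds).mul (hQ.contDiffAt.comp 0 hψ)
  have hdet : S.det * S.det * H.det = 1 := by
    have := congrArg Matrix.det hSHS
    rw [Matrix.det_mul, Matrix.det_mul, Matrix.det_transpose, Matrix.det_one] at this
    linarith
  have hHpos : 0 < H.det := by
    have h1 : 0 < S.det * S.det := mul_self_pos.2 hS
    exact pos_of_mul_pos_right (by rw [hdet]; exact one_pos) h1.le
  -- The determinant factor is the volume distortion `|det S|` of the normalizing coordinates.
  have hg0 : g 0 = Q θ * H.det ^ (-(1 / 2) : ℝ) := by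
    have h1 : |S.det| = H.det ^ (-(1 / 2) : ℝ) := by
      rw [Real.rpow_neg hHpos.le, ← Real.sqrt_eq_rpow, ← Real.sqrt_inv,
        ← Real.sqrt_mul_self_eq_abs]
      congr 1
      exact eq_inv_of_mul_eq_one_left hdet
    simp only [hg]
    rw [normDet_eq_abs_det_of_orthonormal hU.1 hD1, h1, hψ0, mul_comm]
  have hlap := laplace_ball (hf.of_le (WithTop.coe_le_coe.2 le_top : (4 : WithTop ℕ∞) ≤ ∞))
    (hgc.of_le two_le_infty) hlm.fderiv_eq_zero hf''
  obtain ⟨ρ, ⟨⟨hball, N, hNo, hθN, himg⟩, K, hK⟩, h2⟩ :=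
    ((hρ.and hlap).and (eventually_ball_of_eventually_nhds (hψ2.and himm))).exists
  refine ⟨N, hNo, hθN, K, fun τ hτ => ?_⟩
  obtain ⟨hint, hest⟩ := hK τ hτ
  have hb : MeasurableSet (Metric.ball (0 : EuclideanSpace ℝ (Fin p)) ρ) := measurableSet_ball
  have hstrict : ∀ x ∈ Metric.ball (0 : EuclideanSpace ℝ (Fin p)) ρ,
      HasStrictFDerivAt ψ (fderiv ℝ ψ x) x := fun x hx =>
    (h2 x hx).1.hasStrictFDerivAt (by simp)
  have hcont : ∀ x ∈ Metric.ball (0 : EuclideanSpace ℝ (Fin p)) ρ,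
      ContinuousAt (fderiv ℝ ψ) x := fun x hx =>
    ((h2 x hx).1.fderiv_right (m := 1) (by norm_num)).continuousAt
  have hinj : Set.InjOn ψ (Metric.ball 0 ρ) := fun x hx z hz hxz => by
    rw [← (hball x hx).2, ← (hball z hz).2, hxz]
  have hfac : ∀ x, LinearMap.normDet
      (fderiv ℝ ψ x : EuclideanSpace ℝ (Fin p) →ₗ[ℝ] EuclideanSpace ℝ (Fin d)) •
        (Real.exp (-(1 / τ) * η (ψ x)) * Q (ψ x)) =
      Real.exp (-(1 / τ) * η θ) * (Real.exp (-(1 / τ) * ((η ∘ ψ) x - (η ∘ ψ) 0)) * g x) := by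
    intro x
    have : -(1 / τ) * η (ψ x) = -(1 / τ) * η θ + -(1 / τ) * ((η ∘ ψ) x - (η ∘ ψ) 0) := by
      simp only [Function.comp, hψ0]; ring
    rw [this, Real.exp_add, smul_eq_mul]
    ring
  have hfin : Module.finrank ℝ (EuclideanSpace ℝ (Fin p)) = p := finrank_euclideanSpace_fin
  have hI := integrableOn_image_iff_integrableOn_normDet_smul hb hstrict hcont hinj
    (fun x hx => (h2 x hx).2) (fun z => Real.exp (-(1 / τ) * η z) * Q z)
  have hE := integral_image_eq_integral_normDet_smul hb hstrict hcont hinj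
    (fun x hx => (h2 x hx).2) (fun z => Real.exp (-(1 / τ) * η z) * Q z)
  rw [hfin, himg] at hI hE
  simp only [hfac] at hI hE
  rw [hfin] at hest
  refine ⟨hI.2 (hint.const_mul _), ?_⟩
  rw [hE, integral_const_mul]
  have hfactor : Real.exp (-(1 / τ) * η θ) *
      (∫ x in Metric.ball 0 ρ, Real.exp (-(1 / τ) * ((η ∘ ψ) x - (η ∘ ψ) 0)) * g x) -
      (2 * Real.pi * τ) ^ (p / 2 : ℝ) * Real.exp (-(1 / τ) * η θ) * Q θ *
        H.det ^ (-(1 / 2) : ℝ) = Real.exp (-(1 / τ) * η θ) *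
      ((∫ x in Metric.ball 0 ρ, Real.exp (-(1 / τ) * ((η ∘ ψ) x - (η ∘ ψ) 0)) * g x) -
        (2 * Real.pi * τ) ^ (p / 2 : ℝ) * g 0) := by
    rw [hg0]; ring
  rw [hfactor, abs_mul, abs_of_pos (Real.exp_pos _), mul_comm]
  gcongr

end TangentChart

/-! ### Exponentially small contributions. -/

section Tail

/-- Contribution of a region where the exponent stays above `c`. -/
lemma integrableOn_exp_mul_and_abs_setIntegral_le {α : Type*} [MeasurableSpace α] {μ : Measure α}
    {f q : α → ℝ} (hf : Measurable f) (hq : Measurable q) (hq0 : ∀ x, 0 ≤ q x) {S : Set α}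
    (hS : MeasurableSet S) {c : ℝ} (hc : ∀ x ∈ S, c ≤ f x) {τ₀ : ℝ}
    (hint : IntegrableOn (fun x => Real.exp (-(1 / τ₀) * f x) * q x) S μ) {τ : ℝ} (hτ : 0 < τ)
    (hτ₀ : τ ≤ τ₀) :
    IntegrableOn (fun x => Real.exp (-(1 / τ) * f x) * q x) S μ ∧
      |∫ x in S, Real.exp (-(1 / τ) * f x) * q x ∂μ| ≤
        Real.exp (-c * (1 / τ - 1 / τ₀)) * ∫ x in S, Real.exp (-(1 / τ₀) * f x) * q x ∂μ := by
  -- Only the surplus `1 / τ - 1 / τ₀` is paired with the bound `c`; the weight at `τ₀` is kept for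
  -- integrability.
  have hinv : 0 ≤ 1 / τ - 1 / τ₀ := sub_nonneg.2 (one_div_le_one_div_of_le hτ hτ₀)
  have hbound : ∀ x ∈ S, ‖Real.exp (-(1 / τ) * f x) * q x‖ ≤
      Real.exp (-c * (1 / τ - 1 / τ₀)) * (Real.exp (-(1 / τ₀) * f x) * q x) := by
    intro x hx
    rw [Real.norm_of_nonneg (mul_nonneg (Real.exp_nonneg _) (hq0 x)), ← mul_assoc, ← Real.exp_add]
    refine mul_le_mul_of_nonneg_right (Real.exp_le_exp.2 ?_) (hq0 x)
    nlinarith [mul_le_mul_of_nonneg_right (hc x hx) hinv]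
  have hae := (ae_restrict_iff' hS).2 (Eventually.of_forall hbound : ∀ᵐ x ∂μ, _)
  have hdom := Integrable.const_mul hint (Real.exp (-c * (1 / τ - 1 / τ₀)))
  refine ⟨hdom.mono' (by fun_prop) hae, ?_⟩
  rw [← integral_const_mul]
  exact norm_integral_le_of_norm_le hdom hae

/-- Exponential decay in `1 / τ → ∞` beats every power; it is used with `q = p / 2` to put the tail
below the local error. -/
lemma eventually_exp_neg_div_le {δ : ℝ} (hδ : 0 < δ) (q : ℝ) :
    ∀ᶠ τ in 𝓝[>] (0 : ℝ), Real.exp (-δ * (1 / τ)) ≤ τ * τ ^ q := by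
  have h := ((isLittleO_exp_neg_mul_rpow_atTop hδ (-(1 + q))).comp_tendsto
    tendsto_inv_nhdsGT_zero).bound one_pos
  filter_upwards [h, self_mem_nhdsWithin] with τ h (hτ : 0 < τ)
  rw [Function.comp_apply, Function.comp_apply, one_mul, Real.norm_of_nonneg (Real.exp_nonneg _),
    Real.norm_of_nonneg (Real.rpow_nonneg (inv_nonneg.2 hτ.le) _), Real.rpow_neg (inv_nonneg.2 hτ.le),
    Real.inv_rpow hτ.le, inv_inv, Real.rpow_add hτ, Real.rpow_one] at h
  rwa [one_div]

end Tail

/-! ### Gluing the local expansion and the tail. -/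

section Fibre

/-- Laplace approximation over a whole fibre, with an absolute error bound. -/
lemma laplace_fibre {F : EuclideanSpace ℝ (Fin d) → EuclideanSpace ℝ (Fin k)}
    {η Q : EuclideanSpace ℝ (Fin d) → ℝ} (hF : ContDiff ℝ ∞ F) (hη : ContDiff ℝ ∞ η)
    (hQ : ContDiff ℝ ∞ Q) (hQ0 : ∀ z, 0 ≤ Q z) {θ : EuclideanSpace ℝ (Fin d)} (hd : d = p + k)
    (hrank : (jacobian F θ).rank = k) {U : Matrix (Fin d) (Fin p) ℝ} (hU : IsTangentFrame F θ U)
    (hmin : ∀ z, F z = F θ → η θ ≤ η z) (hns : (manifoldHessian F η θ U).det ≠ 0)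
    (hsep : ∀ N ∈ 𝓝 θ, ∃ δ > 0, ∀ z ∈ F ⁻¹' {F θ} \ N, η θ + δ ≤ η z)
    {τ₀ : ℝ} (hτ₀ : 0 < τ₀)
    (hint : IntegrableOn (fun z => Real.exp (-(1 / τ₀) * η z) * Q z) (F ⁻¹' {F θ})
      (Measure.euclideanHausdorffMeasure p)) :
    ∃ K : ℝ, ∀ᶠ τ in 𝓝[>] (0 : ℝ),
      IntegrableOn (fun z => Real.exp (-(1 / τ) * η z) * Q z) (F ⁻¹' {F θ})
        (Measure.euclideanHausdorffMeasure p) ∧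
      |(∫ z in F ⁻¹' {F θ}, Real.exp (-(1 / τ) * η z) * Q z
          ∂(Measure.euclideanHausdorffMeasure p)) -
        (2 * Real.pi * τ) ^ (p / 2 : ℝ) * Real.exp (-(1 / τ) * η θ) * Q θ *
          (manifoldHessian F η θ U).det ^ (-(1 / 2) : ℝ)| ≤
        K * τ * τ ^ (p / 2 : ℝ) * Real.exp (-(1 / τ) * η θ) := by
  obtain ⟨N, hNo, hθN, K, hK⟩ := laplace_fibre_nhds hF hη hQ hd hrank hU hmin hns
  obtain ⟨δ, hδ, hsepN⟩ := hsep N (hNo.mem_nhds hθN)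
  have hMm : MeasurableSet (F ⁻¹' {F θ}) :=
    (isClosed_singleton.preimage hF.continuous).measurableSet
  set M := F ⁻¹' {F θ} with hM
  -- The tail bound factors into this `τ`-independent constant, `exp (-δ / τ)` and `exp (-η θ / τ)`.
  set C := Real.exp ((η θ + δ) * (1 / τ₀)) *
    ∫ z in M \ N, Real.exp (-(1 / τ₀) * η z) * Q z ∂(Measure.euclideanHausdorffMeasure p) with hC
  have hC0 : 0 ≤ C := mul_nonneg (Real.exp_nonneg _)
    (integral_nonneg fun z => mul_nonneg (Real.exp_nonneg _) (hQ0 z))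
  refine ⟨K + C, ?_⟩
  filter_upwards [eventually_exp_neg_div_le hδ (p / 2 : ℝ), self_mem_nhdsWithin,
    Ioc_mem_nhdsGT hτ₀] with τ hexp (hτ : 0 < τ) hττ₀
  obtain ⟨hi₁, he₁⟩ := hK τ hτ
  obtain ⟨hi₂, he₂⟩ := integrableOn_exp_mul_and_abs_setIntegral_le hη.continuous.measurable
    hQ.continuous.measurable hQ0 (hMm.diff hNo.measurableSet) hsepN
    (hint.mono_set Set.sdiff_subset) hτ hττ₀.2
  have hunion : M ∩ N ∪ M \ N = M := Set.inter_union_sdiff M N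
  have hsplit := setIntegral_union (Set.disjoint_sdiff_inter.symm) (hMm.diff hNo.measurableSet)
    hi₁ hi₂
  rw [hunion] at hsplit
  refine ⟨hunion ▸ hi₁.union hi₂, ?_⟩
  have htail : Real.exp (-(η θ + δ) * (1 / τ - 1 / τ₀)) *
      (∫ z in M \ N, Real.exp (-(1 / τ₀) * η z) * Q z ∂(Measure.euclideanHausdorffMeasure p)) =
      C * Real.exp (-δ * (1 / τ)) * Real.exp (-(1 / τ) * η θ) := by
    rw [hC, mul_right_comm _ _ (Real.exp (-δ * (1 / τ))), mul_right_comm _ _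
      (Real.exp (-(1 / τ) * η θ)), ← Real.exp_add, ← Real.exp_add]
    congr 2
    ring
  rw [htail] at he₂
  have hle : C * Real.exp (-δ * (1 / τ)) * Real.exp (-(1 / τ) * η θ) ≤
      C * (τ * τ ^ (p / 2 : ℝ)) * Real.exp (-(1 / τ) * η θ) := by gcongr
  rw [hsplit, add_sub_right_comm]
  refine (abs_add_le _ _).trans ((add_le_add he₁ (he₂.trans hle)).trans_eq ?_)
  ring

end Fibre

end ConstrainedLaplace

end

/-! ### From absolute to relative error. -/

theorem mainTheorem4 (d m n : ℕ) (hd : m * n ≤ d)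
    (F : EuclideanSpace ℝ (Fin d) → EuclideanSpace ℝ (Fin (m * n)))
    (hF : ContDiff ℝ ∞ F)
    (y : EuclideanSpace ℝ (Fin (m * n)))
    (M : Set (EuclideanSpace ℝ (Fin d))) (hM : M = F ⁻¹' {y})
    (hrank : ∀ θ ∈ M, (ConstrainedLaplace.jacobian F θ).rank = m * n)
    (η Q : EuclideanSpace ℝ (Fin d) → ℝ)
    (hη : ContDiff ℝ ∞ η) (hQ : ContDiff ℝ ∞ Q)
    (hη_nonneg : ∀ θ, 0 ≤ η θ) (hQ_nonneg : ∀ θ, 0 ≤ Q θ)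
    (θs : EuclideanSpace ℝ (Fin d)) (hθs : θs ∈ M)
    (hmin : ∀ θ ∈ M, θ ≠ θs → η θs < η θ)
    (hsep : ∀ N ∈ 𝓝 θs, ∃ δ > 0, ∀ θ ∈ M \ N, η θs + δ ≤ η θ)
    (hQs : Q θs ≠ 0)
    (hint : ∃ τ₀ > 0, IntegrableOn (fun θ => Real.exp (-(1 / τ₀) * η θ) * Q θ) M
      (Measure.euclideanHausdorffMeasure (d - m * n)))
    (U : Matrix (Fin d) (Fin (d - m * n)) ℝ)
    (hU : ConstrainedLaplace.IsTangentFrame F θs U)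
    (hns : (ConstrainedLaplace.manifoldHessian F η θs U).det ≠ 0) :
    0 < (ConstrainedLaplace.manifoldHessian F η θs U).det ∧
    ∃ r : ℝ → ℝ, r =O[𝓝[>] 0] (fun τ => τ) ∧
      ∀ᶠ τ in 𝓝[>] (0 : ℝ),
        IntegrableOn (fun θ => Real.exp (-(1 / τ) * η θ) * Q θ) M
          (Measure.euclideanHausdorffMeasure (d - m * n)) ∧
        ∫ θ in M, Real.exp (-(1 / τ) * η θ) * Q θ
            ∂(Measure.euclideanHausdorffMeasure (d - m * n)) =
          (2 * Real.pi * τ) ^ (((d : ℝ) - (m : ℝ) * (n : ℝ)) / 2) *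
            Real.exp (-(1 / τ) * η θs) * Q θs *
            (ConstrainedLaplace.manifoldHessian F η θs U).det ^ (-(1 / 2) : ℝ) *
            (1 + r τ) := by
  obtain rfl : F θs = y := by rw [hM] at hθs; exact hθs
  subst hM
  have hdim : d = (d - m * n) + m * n := (Nat.sub_add_cancel hd).symm
  have hle : ∀ z, F z = F θs → η θs ≤ η z := fun z hz => by
    rcases eq_or_ne z θs with rfl | hne
    · exact le_rfl
    · exact (hmin z hz hne).le
  have hdet : 0 < (ConstrainedLaplace.manifoldHessian F η θs U).det :=
    ((ConstrainedLaplace.manifoldHessian_posSemidef hF hη hdim (hrank θs hθs) hU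
      hle).posDef_iff_det_ne_zero.2 hns).det_pos
  refine ⟨hdet, ?_⟩
  obtain ⟨τ₀, hτ₀, hint⟩ := hint
  obtain ⟨K, hK⟩ := ConstrainedLaplace.laplace_fibre hF hη hQ hQ_nonneg hdim (hrank θs hθs) hU
    hle hns hsep hτ₀ hint
  have hexponent : ((d : ℝ) - (m : ℝ) * (n : ℝ)) / 2 = ((d - m * n : ℕ) : ℝ) / 2 := by
    rw [Nat.cast_sub hd, Nat.cast_mul]
  rw [hexponent]
  set q : ℝ := ((d - m * n : ℕ) : ℝ) / 2
  set D : ℝ := (ConstrainedLaplace.manifoldHessian F η θs U).det ^ (-(1 / 2) : ℝ) with hD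
  have hD0 : 0 < D := Real.rpow_pos_of_pos hdet _
  have hQ0 : 0 < Q θs := (hQ_nonneg θs).lt_of_ne' hQs
  set I : ℝ → ℝ := fun τ => ∫ θ in F ⁻¹' {F θs}, Real.exp (-(1 / τ) * η θ) * Q θ
    ∂(Measure.euclideanHausdorffMeasure (d - m * n)) with hI
  set L : ℝ → ℝ := fun τ => (2 * Real.pi * τ) ^ q * Real.exp (-(1 / τ) * η θs) * Q θs * D with hL
  have hL0 : ∀ τ, 0 < τ → 0 < L τ := fun τ hτ => by
    have : 0 < 2 * Real.pi * τ := by positivity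
    positivity
  have hpi : (0 : ℝ) < (2 * Real.pi) ^ q := Real.rpow_pos_of_pos (by positivity) _
  -- The powers `τ ^ q` and the factor `exp (-η θs / τ)` cancel between the error bound and `L τ`,
  -- leaving this constant times `τ`.
  refine ⟨fun τ => (I τ - L τ) / L τ,
    Asymptotics.IsBigO.of_bound (K / ((2 * Real.pi) ^ q * Q θs * D)) ?_, ?_⟩
  · filter_upwards [hK, self_mem_nhdsWithin] with τ hKτ (hτ : 0 < τ)
    have hτq : 0 < τ ^ q := Real.rpow_pos_of_pos hτ _
    rw [Real.norm_eq_abs, abs_div, abs_of_pos (hL0 τ hτ), div_le_iff₀ (hL0 τ hτ),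
      Real.norm_of_nonneg hτ.le]
    refine hKτ.2.trans_eq ?_
    simp only [hL]
    rw [Real.mul_rpow (by positivity) hτ.le]
    field_simp
  · filter_upwards [hK, self_mem_nhdsWithin] with τ hKτ (hτ : 0 < τ)
    refine ⟨hKτ.1, ?_⟩
    change I τ = L τ * (1 + (I τ - L τ) / L τ)
    field_simp [(hL0 τ hτ).ne']
    ring
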